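/- Let $\pi$ be a non-empty set of primes and $\mathbb{Z}_\pi=\prod_{p\in\pi}\mathbb{Z}_p$. Let $(G,\mathcal{S})$ be a profinite group pair: $G$ is a profinite group and $\mathcal{S}=\{S_x\}_{x\in X}$ is a family of subgroups of $G$ continuously indexed by a non-empty profinite space $X$, i.e. $\mathcal{S}=\{(g,x)\in G\times X: g\in S_x\}$ is closed in $G\times X$. Let $A$ be a finite $\pi$-primary $G$-module (discrete, with continuous action). Let $G/\mathcal{S}=\bigsqcup_{x\in X} G/S_x$ with the quotient topology from $G\times X$, let $\mathrm{ev}\colon\mathbb{Z}_\pi[\![G/\mathcal{S}]\!]\to\mathbb{Z}_\pi$ be the augmentation of the free profinite $\mathbb{Z}_\pi$-module on $G/\mathcal{S}$, and let $\Delta=\ker(\mathrm{ev})$. Define $H^2(G,\mathcal{S};A)=H^1(G;\mathrm{Hom}(\Delta,A))$ (continuous cohomology with coefficients in the discrete group of continuous homomorphisms $\Delta\to A$ with the diagonal $G$-action). A relative extension of $(G,\mathcal{S})$ by $A$ is a pair $(E,q)$, where $0\to A\to E\xrightarrow{p}G\to1$ is an extension of profinite groups inducing the given action of $G$ on $A$,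 and $q\colon\mathcal{S}\to E$ is a continuous map whose restriction $q_x\colon S_x\to E$ is, for each $x\in X$, a homomorphism with $pq_x=\mathrm{id}_{S_x}$. Relative extensions $(E,q)$ and $(\tilde E,\tilde q)$ are equivalent if there are an equivalence of extensions $f\colon E\to\tilde E$ (an isomorphism of topological groups inducing the identity on $A$ and on $G$) and a continuous function $a\colon X\to A$ with $\tilde q_x(s)=a_x\cdot f(q_x(s))\cdot a_x^{-1}$ for all $x\in X$ and $s\in S_x$. Then there is a bijection $\Phi=\Phi_{G,\mathcal{S},A}$ from $H^2(G,\mathcal{S};A)$ to the set of equivalence classes of relative extensions of $(G,\mathcal{S})$ by $A$, which is natural in the following senses. 1. It is given on cocycles as follows: $\Phi(c)$ is the class of $(E,q)$ if and only if there are a continuous cocycle $\xi\colon G\to\mathrm{Hom}(\Delta,A)$ representing $c$, a continuous map $\eta\colon G\to\mathrm{Hom}(\mathbb{Z}_\pi[\![G/\mathcal{S}]\!],A)$ with $\eta(g)|_\Delta=\xi(g)$ for all $g\in G$, a function $\zeta\colon G\times G\to A$, and a continuous set-theoretic section $r\colon G\to E$ of $p$, such that $(g\cdot\eta(h)-\eta(gh)+\eta(g))(y)=\zeta(g,h)$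 and $r(g)r(h)=\zeta(g,h)\,r(gh)$ for all $g,h\in G$ and $y\in G/\mathcal{S}$, and $q_x(s)=(-\eta(s)(1S_x))\,r(s)$ for all $x\in X$ and $s\in S_x$. 2. It is functorial. Let $(G',\mathcal{S}')$ be another such pair, indexed by $X'$, and let $A'$ be a finite $\pi$-primary $G'$-module. Let $\alpha\colon G'\to G$ be a continuous homomorphism and $f\colon X'\to X$ a continuous map with $\alpha(S'_x)\subseteq S_{f(x)}$ for all $x\in X'$, and let $\varphi\colon A\to A'$ be a homomorphism with $\varphi(\alpha(g)\cdot a)=g\cdot\varphi(a)$ for all $g\in G'$ and $a\in A$. Let $\Phi(c)$ be the class of $(E,q)$, and let $c'\in H^2(G',\mathcal{S}';A')$ be the image of $c$ under the map induced by $(\alpha,f,\varphi)$. Then $\Phi(c')$ is the class of a relative extension $(E',q')$ if and only if there are a continuous homomorphism $F\colon E\times_G G'\to E'$ over $G'$ which restricts to $\varphi$ on $A$ and a continuous function $a\colon X'\to A'$ such that $q'_x(s)=a_x\cdot F\big(q_{f(x)}(\alpha(s)),s\big)\cdot a_x^{-1}$ for all $x\in X'$ and $s\in S'_x$. -/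

import Mathlib

universe u v w

open Topology

noncomputable section

namespace RelCohom

/-! ## The ring of `π`-adic integers -/

instance factPrime (p : Nat.Primes) : Fact (p : ℕ).Prime := ⟨p.2⟩

/-- The profinite ring `ℤ_π = ∏_{p ∈ π} ℤ_p`, for a set `π` of primes. -/
abbrev PiAdicInt (π : Set Nat.Primes) : Type := ∀ p : π, ℤ_[(p : Nat.Primes)]

/-! ## Free profinite modules -/

section FreeProfinite

variable (R : Type*) [CommRing R]

/-- The inverse limit `lim R[Q]` over the discrete quotients `Q` of the space `Y`, where `R[Q]`
is the abstract free module on `Q`, as a submodule of the product of all the `R[Q]`. -/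
def freeProfiniteSubmodule (Y : Type*) [TopologicalSpace Y] :
    Submodule R (∀ Q : DiscreteQuotient Y, (Q →₀ R)) where
  carrier := {m | ∀ (Q Q' : DiscreteQuotient Y) (h : Q ≤ Q'),
    Finsupp.mapDomain (DiscreteQuotient.ofLE h) (m Q) = m Q'}
  add_mem' := by
    intro a b ha hb Q Q' h
    simp only [Pi.add_apply, Finsupp.mapDomain_add, ha Q Q' h, hb Q Q' h]
  zero_mem' := by
    intro Q Q' h
    simp
  smul_mem' := by
    intro c a ha Q Q' h
    simp only [Pi.smul_apply, Finsupp.mapDomain_smul, ha Q Q' h]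

/-- The free profinite module `R⟦Y⟧ = lim R[Q]` on the profinite space `Y`, where `R` is a
profinite ring. -/
def FreeProfinite (Y : Type*) [TopologicalSpace Y] : Type _ := freeProfiniteSubmodule R Y

variable {R} {Y Y' Y'' : Type*} [TopologicalSpace Y] [TopologicalSpace Y'] [TopologicalSpace Y'']

namespace FreeProfinite

instance : AddCommGroup (FreeProfinite R Y) :=
  inferInstanceAs (AddCommGroup (freeProfiniteSubmodule R Y))

instance : Module R (FreeProfinite R Y) :=
  inferInstanceAs (Module R (freeProfiniteSubmodule R Y))

/-- The coefficient of `m` at the point `q` of the discrete quotient `Q`. -/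
def coeff (m : FreeProfinite R Y) (Q : DiscreteQuotient Y) : Q →₀ R := m.1 Q

/-- The inverse limit topology: the coarsest one for which all coefficients are continuous. -/
instance [TopologicalSpace R] : TopologicalSpace (FreeProfinite R Y) :=
  TopologicalSpace.induced
    (fun m (z : Σ Q : DiscreteQuotient Y, Q) => coeff m z.1 z.2) inferInstance

theorem coeff_add (a b : FreeProfinite R Y) (Q : DiscreteQuotient Y) :
    coeff (a + b) Q = coeff a Q + coeff b Q := rfl

theorem coeff_compat (m : FreeProfinite R Y) {Q Q' : DiscreteQuotient Y} (h : Q ≤ Q') :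
    Finsupp.mapDomain (DiscreteQuotient.ofLE h) (coeff m Q) = coeff m Q' := m.2 Q Q' h

theorem ext_coeff {a b : FreeProfinite R Y} (h : ∀ Q, coeff a Q = coeff b Q) : a = b :=
  Subtype.ext (funext h)

theorem continuous_coeff [TopologicalSpace R] (Q : DiscreteQuotient Y) (q : Q) :
    Continuous (fun m : FreeProfinite R Y => coeff m Q q) := by
  have h : Continuous (fun (m : FreeProfinite R Y) (z : Σ Q : DiscreteQuotient Y, Q) =>
    coeff m z.1 z.2) := continuous_induced_dom
  exact continuous_pi_iff.1 h ⟨Q, q⟩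

/-- The canonical map `Y → R⟦Y⟧`. -/
def dirac (y : Y) : FreeProfinite R Y :=
  ⟨fun Q => Finsupp.single (Q.proj y) 1, by
    intro Q Q' h
    rw [Finsupp.mapDomain_single, DiscreteQuotient.ofLE_proj]⟩

/-- The augmentation (evaluation) `R⟦Y⟧ → R`, the sum of the coefficients; it sends every
`y ∈ Y` to `1`.  It may be read off at any discrete quotient. -/
def ev : FreeProfinite R Y →ₗ[R] R where
  toFun m := (coeff m ⊤).sum fun _ r => r
  map_add' a b := by
    rw [coeff_add]
    exact Finsupp.sum_add_index' (fun _ => rfl) (fun _ _ _ => rfl)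
  map_smul' c a := by
    change ((c • coeff a ⊤).sum fun _ r => r) = c • ((coeff a ⊤).sum fun _ r => r)
    rw [Finsupp.sum_smul_index (fun _ => rfl), Finsupp.smul_sum]
    rfl

theorem ev_eq (m : FreeProfinite R Y) (Q : DiscreteQuotient Y) :
    ev m = (coeff m Q).sum fun _ r => r := by
  change ((coeff m ⊤).sum fun _ r => r) = _
  rw [← coeff_compat m (le_top : Q ≤ ⊤)]
  exact Finsupp.sum_mapDomain_index (fun _ => rfl) (fun _ _ _ => rfl)

theorem ev_dirac (y : Y) : ev (dirac y : FreeProfinite R Y) = 1 := by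
  change (Finsupp.single ((⊤ : DiscreteQuotient Y).proj y) (1 : R)).sum (fun _ r => r) = 1
  exact Finsupp.sum_single_index rfl

/-- The homomorphism `R⟦Y⟧ → R⟦Y'⟧` induced by a continuous map `Y → Y'`. -/
def map (f : C(Y, Y')) : FreeProfinite R Y →ₗ[R] FreeProfinite R Y' where
  toFun m := ⟨fun Q => Finsupp.mapDomain
      (DiscreteQuotient.map f (le_refl (Q.comap f))) (coeff m (Q.comap f)), by
    intro Q Q' h
    change Finsupp.mapDomain _ (Finsupp.mapDomain _ (coeff m (Q.comap f))) =
      Finsupp.mapDomain _ (coeff m (Q'.comap f))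
    rw [← coeff_compat m (DiscreteQuotient.comap_mono f h), ← Finsupp.mapDomain_comp,
      ← Finsupp.mapDomain_comp]
    congr 1
    funext q
    obtain ⟨y, rfl⟩ := DiscreteQuotient.proj_surjective _ q
    rfl⟩
  map_add' a b := ext_coeff fun Q => Finsupp.mapDomain_add
  map_smul' c a := ext_coeff fun Q => Finsupp.mapDomain_smul _ _

theorem coeff_map (f : C(Y, Y')) (m : FreeProfinite R Y) (Q : DiscreteQuotient Y') :
    coeff (map f m) Q = Finsupp.mapDomain
      (DiscreteQuotient.map f (le_refl (Q.comap f))) (coeff m (Q.comap f)) := rfl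

theorem map_id (m : FreeProfinite R Y) : map (ContinuousMap.id Y) m = m := by
  refine ext_coeff fun Q => ?_
  rw [coeff_map]
  exact (congrArg (fun g => Finsupp.mapDomain g (coeff m Q))
    (DiscreteQuotient.map_id (A := Q))).trans Finsupp.mapDomain_id

theorem map_map (g : C(Y', Y'')) (f : C(Y, Y')) (m : FreeProfinite R Y) :
    map g (map f m) = map (g.comp f) m := by
  refine ext_coeff fun Q => ?_
  rw [coeff_map, coeff_map, coeff_map, ← Finsupp.mapDomain_comp]
  congr 1
  funext q
  obtain ⟨y, rfl⟩ := DiscreteQuotient.proj_surjective _ q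
  rfl

theorem ev_map (f : C(Y, Y')) (m : FreeProfinite R Y) : ev (map f m) = ev m := by
  rw [ev_eq m ((⊤ : DiscreteQuotient Y').comap f), ev_eq (map f m) ⊤, coeff_map]
  exact Finsupp.sum_mapDomain_index (fun _ => rfl) (fun _ _ _ => rfl)

theorem map_dirac (f : C(Y, Y')) (y : Y) :
    map f (dirac y : FreeProfinite R Y) = dirac (f y) :=
  ext_coeff fun _ => Finsupp.mapDomain_single

theorem continuous_map [TopologicalSpace R] (f : C(Y, Y')) :
    Continuous (map f : FreeProfinite R Y → FreeProfinite R Y') := by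
  refine continuous_induced_rng.2 (continuous_pi ?_)
  rintro ⟨Q, q⟩
  have hinj : Function.Injective (DiscreteQuotient.map f (le_refl (Q.comap f))) := by
    intro a b hab
    obtain ⟨y, rfl⟩ := DiscreteQuotient.proj_surjective _ a
    obtain ⟨z, rfl⟩ := DiscreteQuotient.proj_surjective _ b
    have h : Q.proj (f y) = Q.proj (f z) := hab
    exact Quotient.sound' (Quotient.exact' h : Q.toSetoid (f y) (f z))
  by_cases hq : q ∈ Set.range (DiscreteQuotient.map f (le_refl (Q.comap f)))
  · obtain ⟨a, rfl⟩ := hq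
    refine (continuous_coeff (R := R) (Q.comap f) a).congr fun m => ?_
    exact (Finsupp.mapDomain_apply hinj (coeff m (Q.comap f)) a).symm
  · refine (continuous_const (y := (0 : R))).congr fun m => ?_
    exact (Finsupp.mapDomain_of_notMem_range (coeff m (Q.comap f)) q hq).symm

end FreeProfinite

end FreeProfinite

/-! ## Continuous homomorphisms with the diagonal action, and first cohomology -/

section Cohomology

/-- The group `Hom(M, A)` of continuous homomorphisms. -/
def ContHom (M A : Type*) [AddCommGroup M] [TopologicalSpace M] [AddCommGroup A]
    [TopologicalSpace A] : Type _ := M →ₜ+ A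

namespace ContHom

variable {M A : Type*} [AddCommGroup M] [TopologicalSpace M] [AddCommGroup A]
  [TopologicalSpace A]

instance : FunLike (ContHom M A) M A := inferInstanceAs (FunLike (M →ₜ+ A) M A)

instance : AddMonoidHomClass (ContHom M A) M A :=
  inferInstanceAs (AddMonoidHomClass (M →ₜ+ A) M A)

instance : ContinuousMapClass (ContHom M A) M A :=
  inferInstanceAs (ContinuousMapClass (M →ₜ+ A) M A)

theorem ext {φ ψ : ContHom M A} (h : ∀ m, φ m = ψ m) : φ = ψ := DFunLike.ext _ _ h

instance [IsTopologicalAddGroup A] : AddCommGroup (ContHom M A) :=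
  inferInstanceAs (AddCommGroup (M →ₜ+ A))

theorem add_apply [IsTopologicalAddGroup A] (φ ψ : ContHom M A) (m : M) :
    (φ + ψ) m = φ m + ψ m := rfl

/-- The diagonal action `(g • φ)(m) = g • φ (g⁻¹ • m)`. -/
instance (G : Type*) [Group G] [DistribMulAction G M] [ContinuousConstSMul G M]
    [DistribMulAction G A] [ContinuousConstSMul G A] [IsTopologicalAddGroup A] :
    DistribMulAction G (ContHom M A) where
  smul g φ := (⟨⟨⟨fun m => g • φ (g⁻¹ • m), by simp⟩, by intro a b; simp⟩,
    ((map_continuous φ).comp (continuous_const_smul g⁻¹)).const_smul g⟩ : M →ₜ+ A)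
  one_smul φ := ext fun m => by
    change (1 : G) • φ ((1 : G)⁻¹ • m) = φ m
    simp
  mul_smul g h φ := ext fun m => by
    change (g * h) • φ ((g * h)⁻¹ • m) = g • h • φ (h⁻¹ • g⁻¹ • m)
    simp [mul_smul]
  smul_zero g := ext fun m => by
    change g • (0 : A) = 0
    simp
  smul_add g φ ψ := ext fun m => by
    change g • (φ (g⁻¹ • m) + ψ (g⁻¹ • m)) = g • φ (g⁻¹ • m) + g • ψ (g⁻¹ • m)
    simp

theorem smul_apply {G : Type*} [Group G] [DistribMulAction G M] [ContinuousConstSMul G M]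
    [DistribMulAction G A] [ContinuousConstSMul G A] [IsTopologicalAddGroup A]
    (g : G) (φ : ContHom M A) (m : M) : (g • φ) m = g • φ (g⁻¹ • m) := rfl

end ContHom

variable (G M : Type*) [Group G] [TopologicalSpace G] [AddCommGroup M] [DistribMulAction G M]

/-- Continuous (i.e. locally constant) 1-cocycles on the topological group `G` with values in the
discrete `G`-module `M`. -/
def contZ1 : AddSubgroup (G → M) where
  carrier := {ξ | IsLocallyConstant ξ ∧ ∀ g h, ξ (g * h) = ξ g + g • ξ h}
  add_mem' := by
    rintro a b ⟨ha, ha'⟩ ⟨hb, hb'⟩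
    refine ⟨ha.add hb, fun g h => ?_⟩
    simp only [Pi.add_apply, ha', hb', smul_add]
    abel
  zero_mem' := ⟨IsLocallyConstant.const 0, by simp⟩
  neg_mem' := by
    rintro a ⟨ha, ha'⟩
    refine ⟨ha.neg, fun g h => ?_⟩
    simp only [Pi.neg_apply, ha', smul_neg]
    abel

/-- The 1-coboundaries `g ↦ g • ω - ω`. -/
def contB1 : AddSubgroup (G → M) where
  carrier := {ξ | ∃ ω : M, ∀ g, ξ g = g • ω - ω}
  add_mem' := by
    rintro a b ⟨ω, h⟩ ⟨ω', h'⟩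
    refine ⟨ω + ω', fun g => ?_⟩
    simp only [Pi.add_apply, h, h', smul_add]
    abel
  zero_mem' := ⟨0, by simp⟩
  neg_mem' := by
    rintro a ⟨ω, h⟩
    refine ⟨-ω, fun g => ?_⟩
    simp only [Pi.neg_apply, h, smul_neg]
    abel

/-- The first continuous cohomology group `H¹(G; M)` of a profinite group with coefficients in a
discrete module. -/
def ContH1 : Type _ := contZ1 G M ⧸ (contB1 G M).addSubgroupOf (contZ1 G M)

instance : AddCommGroup (ContH1 G M) :=
  inferInstanceAs (AddCommGroup (contZ1 G M ⧸ (contB1 G M).addSubgroupOf (contZ1 G M)))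

variable {G M}

/-- The class of a cocycle. -/
def ContH1.mk : contZ1 G M →+ ContH1 G M :=
  QuotientAddGroup.mk' ((contB1 G M).addSubgroupOf (contZ1 G M))

/-- The map `H¹(G; M) → H¹(G'; M')` induced by a continuous homomorphism `α : G' → G` and a
compatible homomorphism `ψ : M → M'`. -/
def ContH1.map {G' M' : Type*} [Group G'] [TopologicalSpace G'] [AddCommGroup M']
    [DistribMulAction G' M'] (α : G' →ₜ* G) (ψ : M →+ M')
    (hψ : ∀ (g' : G') (m : M), ψ (α g' • m) = g' • ψ m) : ContH1 G M →+ ContH1 G' M' :=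
  QuotientAddGroup.map _ _
    ({ toFun := fun ξ => ⟨fun g' => ψ (ξ.1 (α g')), by
          refine ⟨(ξ.2.1.comp_continuous (map_continuous α)).comp ψ, fun g h => ?_⟩
          change ψ (ξ.1 (α (g * h))) = ψ (ξ.1 (α g)) + g • ψ (ξ.1 (α h))
          rw [map_mul, ξ.2.2, map_add, hψ]⟩
       map_zero' := Subtype.ext (funext fun _ => map_zero ψ)
       map_add' := fun a b => Subtype.ext (funext fun _ => map_add ψ _ _) } :
      contZ1 G M →+ contZ1 G' M')
    (by
      rintro ξ ⟨ω, h⟩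
      refine ⟨ψ ω, fun g' => ?_⟩
      change ψ (ξ.1 (α g')) = _
      have h' : ξ.1 (α g') = α g' • ω - ω := h (α g')
      rw [h', map_sub, hψ])

end Cohomology

/-! ## Profinite group pairs -/

/-- A profinite group `G` with a family `S = (S x)` of subgroups continuously indexed by the
non-empty profinite space `X`. -/
structure ProfiniteGroupPair where
  /-- the group -/
  G : ProfiniteGrp.{u}
  /-- the index space -/
  X : Profinite.{v}
  nonempty : Nonempty X
  /-- the family of subgroups -/
  S : X → Subgroup G
  isClosed_family : IsClosed {z : G × X | z.1 ∈ S z.2}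

namespace ProfiniteGroupPair

variable (P : ProfiniteGroupPair.{u, v})

/-- The closed subspace `{(g, x) | g ∈ S x}` of `G × X`. -/
abbrev Family : Type _ := {z : P.G × P.X // z.1 ∈ P.S z.2}

/-- Two pairs `(g, x)`, `(g', x')` define the same coset iff `x = x'` and `g (S x) = g' (S x)`. -/
def cosetSetoid : Setoid (P.G × P.X) where
  r a b := a.2 = b.2 ∧ a.1⁻¹ * b.1 ∈ P.S a.2
  iseqv :=
    { refl := fun a => ⟨rfl, by simp [one_mem]⟩
      symm := by
        rintro ⟨g, x⟩ ⟨h, y⟩ ⟨e, m⟩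
        obtain rfl : x = y := e
        exact ⟨rfl, by simpa using inv_mem m⟩
      trans := by
        rintro ⟨g, x⟩ ⟨h, y⟩ ⟨k, z⟩ ⟨e, m⟩ ⟨e', m'⟩
        obtain rfl : x = y := e
        obtain rfl : x = z := e'
        exact ⟨rfl, by simpa [mul_assoc] using mul_mem m m'⟩ }

/-- The space `G/S`, the disjoint union of the `G / S x`, with the quotient topology
from `G × X`. -/
def Cosets : Type _ := Quotient P.cosetSetoid

instance : TopologicalSpace P.Cosets :=
  inferInstanceAs (TopologicalSpace (Quotient P.cosetSetoid))

/-- The coset `g (S x)`. -/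
def coset (g : P.G) (x : P.X) : P.Cosets := Quotient.mk P.cosetSetoid (g, x)

/-- Left translation by `g` on `G/S`. -/
def translate (g : P.G) : C(P.Cosets, P.Cosets) where
  toFun := Quotient.map (sa := P.cosetSetoid) (sb := P.cosetSetoid) (fun a => (g * a.1, a.2)) (by
    rintro a b ⟨e, m⟩
    exact ⟨e, by simpa [mul_assoc] using m⟩)
  continuous_toFun := Continuous.quotient_map' (by fun_prop) _

theorem translate_one : P.translate 1 = ContinuousMap.id _ := by
  ext y
  induction y using Quotient.inductionOn with
  | h a => exact congrArg (Quotient.mk P.cosetSetoid) (Prod.ext (one_mul _) rfl)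

theorem translate_mul (g h : P.G) :
    P.translate (g * h) = (P.translate g).comp (P.translate h) := by
  ext y
  induction y using Quotient.inductionOn with
  | h a => exact congrArg (Quotient.mk P.cosetSetoid) (Prod.ext (mul_assoc _ _ _) rfl)

variable (π : Set Nat.Primes)

/-- The permutation module `ℤ_π⟦G/S⟧`. -/
abbrev PermModule : Type _ := FreeProfinite (PiAdicInt π) P.Cosets

instance : DistribMulAction P.G (P.PermModule π) where
  smul g m := FreeProfinite.map (P.translate g) m
  one_smul m := by
    change FreeProfinite.map (P.translate 1) m = m
    rw [translate_one, FreeProfinite.map_id]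
  mul_smul g h m := by
    change FreeProfinite.map (P.translate (g * h)) m =
      FreeProfinite.map (P.translate g) (FreeProfinite.map (P.translate h) m)
    rw [translate_mul, FreeProfinite.map_map]
  smul_zero g := map_zero (FreeProfinite.map (P.translate g))
  smul_add g := map_add (FreeProfinite.map (P.translate g))

theorem smul_def (g : P.G) (m : P.PermModule π) :
    g • m = FreeProfinite.map (P.translate g) m := rfl

instance : ContinuousConstSMul P.G (P.PermModule π) where
  continuous_const_smul g := FreeProfinite.continuous_map (P.translate g)

/-- The module `Δ`, the kernel of the augmentation `ℤ_π⟦G/S⟧ → ℤ_π`. -/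
def Delta : Type _ :=
  LinearMap.ker (FreeProfinite.ev : P.PermModule π →ₗ[PiAdicInt π] PiAdicInt π)

instance : AddCommGroup (P.Delta π) := inferInstanceAs (AddCommGroup
  (LinearMap.ker (FreeProfinite.ev : P.PermModule π →ₗ[PiAdicInt π] PiAdicInt π)))

instance : TopologicalSpace (P.Delta π) := inferInstanceAs (TopologicalSpace
  (LinearMap.ker (FreeProfinite.ev : P.PermModule π →ₗ[PiAdicInt π] PiAdicInt π)))

variable {P π} in
/-- The inclusion `Δ → ℤ_π⟦G/S⟧`. -/
def Delta.inc : P.Delta π →+ P.PermModule π := (LinearMap.ker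
  (FreeProfinite.ev : P.PermModule π →ₗ[PiAdicInt π] PiAdicInt π)).subtype.toAddMonoidHom

theorem Delta.inc_injective : Function.Injective (Delta.inc : P.Delta π → P.PermModule π) :=
  Subtype.val_injective

theorem Delta.continuous_inc : Continuous (Delta.inc : P.Delta π → P.PermModule π) :=
  continuous_subtype_val

instance : DistribMulAction P.G (P.Delta π) where
  smul g m := ⟨g • Delta.inc m, by
    rw [LinearMap.mem_ker, smul_def, FreeProfinite.ev_map]
    exact m.2⟩
  one_smul m := Subtype.ext (one_smul P.G (Delta.inc m))
  mul_smul g h m := Subtype.ext (mul_smul g h (Delta.inc m))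
  smul_zero g := Subtype.ext (smul_zero g)
  smul_add g a b := Subtype.ext (smul_add g (Delta.inc a) (Delta.inc b))

theorem Delta.inc_smul (g : P.G) (m : P.Delta π) : Delta.inc (g • m) = g • Delta.inc m := rfl

instance : ContinuousConstSMul P.G (P.Delta π) where
  continuous_const_smul g := Continuous.subtype_mk
    ((Delta.continuous_inc P π).const_smul g) _

end ProfiniteGroupPair

/-- A finite `π`-primary `G`-module: the order of each element has all its prime factors
in `π`.  The action is continuous for the discrete topology on `A`. -/
structure FiniteModule (π : Set Nat.Primes) (G : ProfiniteGrp.{u}) where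
  /-- the underlying group -/
  A : Type w
  [addCommGroup : AddCommGroup A]
  [topologicalSpace : TopologicalSpace A]
  [discreteTopology : DiscreteTopology A]
  [finite : Finite A]
  [action : DistribMulAction G A]
  [continuousSMul : ContinuousSMul G A]
  primary : ∀ (a : A) (p : Nat.Primes), (p : ℕ) ∣ addOrderOf a → p ∈ π

attribute [instance] FiniteModule.addCommGroup FiniteModule.topologicalSpace
  FiniteModule.discreteTopology FiniteModule.finite FiniteModule.action
  FiniteModule.continuousSMul

/-- The relative cohomology group `H²(G, S; A) = H¹(G; Hom(Δ, A))`. -/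
abbrev RelH2 {π : Set Nat.Primes} (P : ProfiniteGroupPair.{u, v}) (M : FiniteModule.{u, w} π P.G) :
    Type _ :=
  ContH1 P.G (ContHom (P.Delta π) M.A)

/-! ## Relative extensions -/

section Extensions

variable {π : Set Nat.Primes}

/-- A relative extension of `(G, S)` by `A`: an extension `0 → A → E → G → 1` of profinite groups
inducing the given action of `G` on `A`, with a family of homomorphisms `q x : S x → E` which are
sections over `S x` and together form a continuous map on `{(g, x) | g ∈ S x}`. -/
structure RelExt (P : ProfiniteGroupPair.{u, v}) (M : FiniteModule.{u, w} π P.G) where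
  /-- the group -/
  E : ProfiniteGrp.{max u w}
  /-- the extension -/
  ext : GroupExtension (Multiplicative M.A) E P.G
  continuous_rightHom : Continuous ext.rightHom
  conj_inl : ∀ (e : E) (a : M.A), e * ext.inl (Multiplicative.ofAdd a) * e⁻¹ =
    ext.inl (Multiplicative.ofAdd (ext.rightHom e • a))
  /-- the splittings -/
  q : ∀ x : P.X, P.S x →* E
  continuous_q : Continuous fun z : P.Family => q z.1.2 ⟨z.1.1, z.2⟩
  rightHom_q : ∀ (x : P.X) (s : P.S x), ext.rightHom (q x s) = s

namespace RelExt

variable {P : ProfiniteGroupPair.{u, v}} {M : FiniteModule.{u, w} π P.G}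

/-- The inclusion `A → E` (which turns addition into multiplication). -/
def ι (X : RelExt P M) (a : M.A) : X.E := X.ext.inl (Multiplicative.ofAdd a)

theorem ι_zero (X : RelExt P M) : X.ι 0 = 1 := map_one X.ext.inl

theorem ι_add (X : RelExt P M) (a b : M.A) : X.ι (a + b) = X.ι a * X.ι b :=
  map_mul X.ext.inl _ _

theorem ι_neg (X : RelExt P M) (a : M.A) : X.ι (-a) = (X.ι a)⁻¹ :=
  map_inv X.ext.inl _

/-- The projection `E → G`. -/
def p (X : RelExt P M) : X.E →ₜ* P.G := ⟨X.ext.rightHom, X.continuous_rightHom⟩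

/-- Equivalence of relative extensions: an isomorphism `f : E → E'` of topological groups over `G`
which is the identity on `A`, such that `f ∘ q x` and `q' x` are conjugate by an element `a x` of
`A` which varies continuously with `x`. -/
def Equivalent (X X' : RelExt P M) : Prop :=
  ∃ f : X.E ≃ₜ* X'.E, (∀ a, f (X.ι a) = X'.ι a) ∧ (∀ e, X'.p (f e) = X.p e) ∧
    ∃ a : P.X → M.A, Continuous a ∧
      ∀ (x : P.X) (s : P.S x), X'.q x s = X'.ι (a x) * f (X.q x s) * (X'.ι (a x))⁻¹

/-- Equivalence of relative extensions is an equivalence relation. -/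
instance setoid (P : ProfiniteGroupPair.{u, v}) (M : FiniteModule.{u, w} π P.G) :
    Setoid (RelExt P M) where
  r := Equivalent
  iseqv :=
    { refl := fun X => ⟨ContinuousMulEquiv.refl _, fun _ => rfl, fun _ => rfl, fun _ => 0,
        continuous_const, fun x s => by simp [ι_zero]⟩
      symm := by
        rintro X X' ⟨f, h1, h2, a, ha, h3⟩
        refine ⟨f.symm, fun b => ?_, fun e => ?_, fun x => -a x, ha.neg, fun x s => ?_⟩
        · rw [← h1, f.symm_apply_apply]
        · rw [← h2, f.apply_symm_apply]
        · rw [h3, map_mul, map_mul, f.symm_apply_apply, map_inv, ← h1, f.symm_apply_apply, ι_neg]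
          group
      trans := by
        rintro X X' X'' ⟨f, h1, h2, a, ha, h3⟩ ⟨f', h1', h2', a', ha', h3'⟩
        refine ⟨f.trans f', fun b => ?_, fun e => ?_, fun x => a' x + a x, ha'.add ha,
          fun x s => ?_⟩
        · change f' (f _) = _
          rw [h1, h1']
        · change X''.p (f' (f _)) = _
          rw [h2', h2]
        · change _ = _ * f' (f _) * _
          rw [h3', h3, map_mul, map_mul, map_inv, h1', ι_add]
          group }

end RelExt

/-- The set of equivalence classes of relative extensions of `(G, S)` by `A`. -/
abbrev RelExtClass (P : ProfiniteGroupPair.{u, v}) (M : FiniteModule.{u, w} π P.G) : Type _ :=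
  Quotient (RelExt.setoid P M)

/-- A class `c` in `H²(G, S; A)` and a relative extension `(E, q)` correspond to each other if
there are a cocycle `ξ` representing `c`, a continuous cochain
`η : G → Hom(ℤ_π⟦G/S⟧, A)` restricting to `ξ` on `Δ`, and a continuous set-theoretic section
`r : G → E`, such that
* the factor set of `r` is the cochain `ζ : G × G → A` with `ev^* ζ = d η`, that is,
  `r g * r h = ζ (g, h) * r (g * h)`, where `(d η (g, h)) y = ζ (g, h)` for all `y ∈ G/S`; and
* `q x s = (- η s (S x)) * r s` for `s ∈ S x`, where `S x` is the trivial coset.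
-/
def Corresponds {P : ProfiniteGroupPair.{u, v}} {M : FiniteModule.{u, w} π P.G}
    (c : RelH2 P M) (X : RelExt P M) : Prop :=
  ∃ (ξ : contZ1 P.G (ContHom (P.Delta π) M.A)) (η : P.G → ContHom (P.PermModule π) M.A)
    (ζ : P.G → P.G → M.A) (r : P.G → X.E),
    ContH1.mk ξ = c ∧
    IsLocallyConstant η ∧ (∀ g δ, η g (ProfiniteGroupPair.Delta.inc δ) = ξ.1 g δ) ∧
    Continuous r ∧ (∀ g, X.p (r g) = g) ∧
    (∀ (g h : P.G) (y : P.Cosets),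
      (g • η h - η (g * h) + η g) (FreeProfinite.dirac y) = ζ g h) ∧
    (∀ g h, r g * r h = X.ι (ζ g h) * r (g * h)) ∧
    (∀ (x : P.X) (s : P.S x),
      X.q x s = X.ι (-η s (FreeProfinite.dirac (P.coset 1 x))) * r s)

/-! ## Functoriality -/

/-- A morphism from the coefficient datum `(G, S, A)` to `(G', S', A')`: a morphism of pairs
`(α, f) : (G', S') → (G, S)` and a homomorphism `φ : A → A'` compatible with `α`. -/
structure DataHom (P : ProfiniteGroupPair.{u, v}) (M : FiniteModule.{u, w} π P.G)
    (P' : ProfiniteGroupPair.{u, v}) (M' : FiniteModule.{u, w} π P'.G) where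
  /-- the homomorphism of groups -/
  α : P'.G →ₜ* P.G
  /-- the map of index spaces -/
  f : C(P'.X, P.X)
  map_mem : ∀ (x : P'.X) (s : P'.G), s ∈ P'.S x → α s ∈ P.S (f x)
  /-- the homomorphism of modules -/
  φ : M.A →+ M'.A
  map_smul : ∀ (g : P'.G) (a : M.A), φ (α g • a) = g • φ a

namespace DataHom

variable {P : ProfiniteGroupPair.{u, v}} {M : FiniteModule.{u, w} π P.G}
  {P' : ProfiniteGroupPair.{u, v}} {M' : FiniteModule.{u, w} π P'.G} (m : DataHom P M P' M')

/-- The induced map `G'/S' → G/S`. -/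
def cosetMap : C(P'.Cosets, P.Cosets) where
  toFun := Quotient.map (sa := P'.cosetSetoid) (sb := P.cosetSetoid)
    (fun a => (m.α a.1, m.f a.2)) (by
      rintro a b ⟨e, h⟩
      exact ⟨congrArg m.f e, by simpa using m.map_mem _ _ h⟩)
  continuous_toFun := Continuous.quotient_map' (by
    exact ((map_continuous m.α).comp continuous_fst).prodMk (m.f.continuous.comp continuous_snd)) _

theorem cosetMap_comp_translate (g : P'.G) :
    m.cosetMap.comp (P'.translate g) = (P.translate (m.α g)).comp m.cosetMap := by
  ext y
  induction y using Quotient.inductionOn with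
  | h a => exact congrArg (Quotient.mk P.cosetSetoid) (Prod.ext (map_mul m.α _ _) rfl)

/-- The induced map `Δ' → Δ`. -/
def deltaMap : P'.Delta π →ₜ+ P.Delta π where
  toFun := fun δ => (⟨FreeProfinite.map m.cosetMap δ.1,
    (FreeProfinite.ev_map m.cosetMap δ.1).trans δ.2⟩ : LinearMap.ker _)
  map_zero' := Subtype.ext (map_zero (FreeProfinite.map m.cosetMap))
  map_add' _ _ := Subtype.ext (map_add (FreeProfinite.map m.cosetMap) _ _)
  continuous_toFun := Continuous.subtype_mk
    ((FreeProfinite.continuous_map m.cosetMap).comp continuous_subtype_val) _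

theorem deltaMap_smul (g : P'.G) (δ : P'.Delta π) :
    m.deltaMap (g • δ) = m.α g • m.deltaMap δ := by
  refine Subtype.ext ?_
  change FreeProfinite.map m.cosetMap (FreeProfinite.map (P'.translate g) δ.1) =
    FreeProfinite.map (P.translate (m.α g)) (FreeProfinite.map m.cosetMap δ.1)
  rw [FreeProfinite.map_map, FreeProfinite.map_map, cosetMap_comp_translate]

/-- The induced map `Hom(Δ, A) → Hom(Δ', A')`, sending `ω` to the composite
`Δ' → Δ → A → A'`. -/
def coeffMap : ContHom (P.Delta π) M.A →+ ContHom (P'.Delta π) M'.A where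
  toFun ω := (⟨⟨⟨fun δ => m.φ (ω (m.deltaMap δ)), by simp⟩, by simp⟩,
    (continuous_of_discreteTopology (f := m.φ)).comp
      ((map_continuous ω).comp (map_continuous m.deltaMap))⟩ : P'.Delta π →ₜ+ M'.A)
  map_zero' := ContHom.ext fun _ => map_zero m.φ
  map_add' _ _ := ContHom.ext fun _ => map_add m.φ _ _

/-- The induced map `H²(G, S; A) → H²(G', S'; A')`. -/
def mapH2 : RelH2 P M →+ RelH2 P' M' :=
  ContH1.map m.α m.coeffMap (by
    intro g ω
    refine ContHom.ext fun δ => ?_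
    change m.φ (m.α g • ω ((m.α g)⁻¹ • m.deltaMap δ)) = g • m.φ (ω (m.deltaMap (g⁻¹ • δ)))
    rw [m.map_smul, deltaMap_smul, map_inv])

/-- `(E', q')` is an image of `(E, q)` under the morphism `m`: there is a continuous homomorphism
`F` over `G'` from the pullback `E ×_G G'` to `E'` extending `φ : A → A'`, and carrying the
pulled back splittings to the `q' x`, up to conjugation by elements of `A'` varying
continuously with `x`. -/
def IsImage (X : RelExt P M) (X' : RelExt P' M') : Prop :=
  ∃ F : ((X.p : X.E →* P.G).comp (MonoidHom.fst X.E P'.G)).eqLocus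
      ((m.α : P'.G →* P.G).comp (MonoidHom.snd X.E P'.G)) →ₜ* X'.E,
    (∀ z, X'.p (F z) = z.1.2) ∧
    (∀ z a, z.1 = (X.ι a, 1) → F z = X'.ι (m.φ a)) ∧
    ∃ a : P'.X → M'.A, Continuous a ∧
      ∀ (x : P'.X) (s : P'.S x) z,
        z.1 = (X.q (m.f x) ⟨m.α s, m.map_mem x s s.2⟩, (s : P'.G)) →
        X'.q x s = X'.ι (a x) * F z * (X'.ι (a x))⁻¹

end DataHom

end Extensions

end RelCohom

end

/-!
Write `Y = G/S` and `R = ℤ_π`.  The space `Y` is profinite, and continuous homomorphisms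
`R⟦Y⟧ → A` are the same as continuous functions `Y → A` (`FreeProfinite.exists_contHom`,
`FreeProfinite.contHom_ext`), because `A` is a module over a finite quotient of `R`.  A point of
`Y` splits the augmentation, so every homomorphism on `Δ` extends to `R⟦Y⟧`, and the extension is
unique up to the constant functions on `Y`.  Hence a class in `H¹(G; Hom(Δ, A))` is represented by a
continuous function `u` on `G × Y` whose coboundary takes values `ζ (g, h)` in the constant
functions (`RelCochain`), and two such functions have the same class iff they differ by a
coboundary up to a function of `g` alone (`RelCochain.cls_eq_iff`).  The rest of the proof is about
these functions.

* From `u` to an extension: `ζ` is a 2-cocycle, `E` is the product `A × G` twisted by `ζ`, and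
  `s ↦ (-u (s, S x), s)` is a homomorphism because `S x` is fixed by `s` (`RelCochain.relExt`).
* From an extension to `u`: the group `A` acts freely on `⊔ E / q (S x)`, which is the coset space
  of another profinite group pair and hence profinite.  A free action of a finite group on a
  profinite space admits a continuous equivariant map to the group (`exists_equivariant`), so both
  `E → G` and `⊔ E / q (S x) → G/S` have continuous sections.  The function `u` measures the failure
  of the second section to commute with the action of the first (`RelExt.exists_realizes`).
* The extension determines the class: the difference of two possible `u` is, after a change of
  section, a cocycle `δ` vanishing at `(s, S x)` for `s ∈ S x`.  As in Shapiro's lemma it is the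
  coboundary of `g (S x) ↦ -δ (g, g (S x))` (`RelCochain.Realizes.cls_eq`).
* Functoriality is a computation with the elements `ι a * r g` of `E`
  (`DataHom.isImage_of_cls_eq`, `DataHom.exists_realizes_of_isImage`).  Its case of the identity
  morphism shows that the class determines the extension up to equivalence.
-/

noncomputable section

namespace RelCohom

/-! ### Reduction of `π`-adic integers -/

theorem isLocallyConstant_toZModPow (p : ℕ) [Fact p.Prime] (n : ℕ) :
    IsLocallyConstant (PadicInt.toZModPow n : ℤ_[p] → ZMod (p ^ n)) := by
  rw [IsLocallyConstant.iff_eventually_eq]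
  intro x
  have hpos : (0 : ℝ) < (p : ℝ) ^ (-n : ℤ) :=
    zpow_pos (by exact_mod_cast (Fact.out : p.Prime).pos) _
  filter_upwards [Metric.closedBall_mem_nhds x hpos] with y hy
  rw [Metric.mem_closedBall, dist_eq_norm, PadicInt.norm_le_pow_iff_mem_span_pow,
    ← PadicInt.ker_toZModPow, RingHom.mem_ker, map_sub, sub_eq_zero] at hy
  exact hy

/-- An element of `ℤ_p` which vanishes modulo the `p`-part of `n` is divisible by `n`, since the
prime-to-`p` part of `n` is a unit. -/
theorem natCast_dvd_of_toZModPow_eq_zero (p : ℕ) [hp : Fact p.Prime] {n : ℕ} (hn : n ≠ 0)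
    {x : ℤ_[p]} (hx : PadicInt.toZModPow (n.factorization p) x = 0) : (n : ℤ_[p]) ∣ x := by
  rw [← RingHom.mem_ker, PadicInt.ker_toZModPow, Ideal.mem_span_singleton] at hx
  have hu : IsUnit (((n / p ^ n.factorization p : ℕ) : ℤ_[p])) := by
    rw [PadicInt.isUnit_iff, PadicInt.norm_natCast_eq_one_iff]
    exact Nat.coprime_ordCompl hp.out hn
  have h : (n : ℤ_[p]) = (p : ℤ_[p]) ^ n.factorization p * ((n / p ^ n.factorization p : ℕ)) := by
    rw [← Nat.cast_pow, ← Nat.cast_mul, Nat.ordProj_mul_ordCompl_eq_self]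
  rw [h]
  exact hu.mul_right_dvd.2 hx

/-- For `n` with all prime factors in `π` there is a continuous reduction homomorphism
`ℤ_π → ℤ/n` with kernel `n ℤ_π`. -/
theorem exists_reduction (π : Set Nat.Primes) {n : ℕ} (hn : n ≠ 0)
    (h : ∀ p : Nat.Primes, (p : ℕ) ∣ n → p ∈ π) :
    ∃ θ : PiAdicInt π →+* ZMod n, IsLocallyConstant θ ∧
      ∀ r, θ r = 0 → ∃ t, r = n • t := by
  let ι : n.primeFactors → π := fun p =>
    ⟨⟨p, Nat.prime_of_mem_primeFactors p.2⟩, h _ (Nat.dvd_of_mem_primeFactors p.2)⟩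
  let θ' : PiAdicInt π →+* ∀ p : n.primeFactors, ZMod ((p : ℕ) ^ n.factorization p) :=
    RingHom.pi fun p => (PadicInt.toZModPow (p := ((ι p : Nat.Primes) : ℕ))
      (n.factorization p)).comp (Pi.evalRingHom _ (ι p))
  refine ⟨(ZMod.equivPi n hn).symm.toRingHom.comp θ', ?_, ?_⟩
  · have h1 : IsLocallyConstant θ' := by
      rw [IsLocallyConstant.iff_eventually_eq]
      intro x
      have h2 : ∀ p : n.primeFactors, ∀ᶠ y in 𝓝 x, θ' y p = θ' x p := fun p =>
        (IsLocallyConstant.iff_eventually_eq _).1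
          ((isLocallyConstant_toZModPow ((ι p : Nat.Primes) : ℕ)
            (n.factorization p)).comp_continuous (continuous_apply (ι p))) x
      filter_upwards [Filter.eventually_all.2 h2] with y hy
      exact funext hy
    exact h1.comp (ZMod.equivPi n hn).symm
  · intro r hr
    have hr' : θ' r = 0 := (ZMod.equivPi n hn).symm.injective (by simpa using hr)
    have key : ∀ p : π, ∃ t : ℤ_[(p : Nat.Primes)], r p = (n : ℤ_[(p : Nat.Primes)]) * t := by
      intro p
      apply natCast_dvd_of_toZModPow_eq_zero ((p : Nat.Primes) : ℕ) hn
      by_cases hp : ((p : Nat.Primes) : ℕ) ∣ n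
      · exact congrFun hr' ⟨_, (Nat.mem_primeFactors_of_ne_zero hn).2 ⟨(p : Nat.Primes).2, hp⟩⟩
      · rw [Nat.factorization_eq_zero_of_not_dvd hp]
        have : Subsingleton (ZMod (((p : Nat.Primes) : ℕ) ^ 0)) := by
          rw [pow_zero]; infer_instance
        exact Subsingleton.elim _ _
    choose t ht using key
    refine ⟨t, funext fun p => ?_⟩
    rw [ht p, Pi.smul_apply, nsmul_eq_mul]

theorem mem_of_dvd_card {π : Set Nat.Primes} {A : Type*} [AddCommGroup A] [Finite A]
    (hA : ∀ (a : A) (p : Nat.Primes), (p : ℕ) ∣ addOrderOf a → p ∈ π) (p : Nat.Primes)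
    (hp : (p : ℕ) ∣ Nat.card A) : p ∈ π := by
  have := Fintype.ofFinite A
  rw [Nat.card_eq_fintype_card] at hp
  obtain ⟨a, ha⟩ := exists_prime_addOrderOf_dvd_card (p : ℕ) hp
  exact hA a p ha.symm.dvd

/-- The scalar multiples of an element `a` of a finite `π`-primary group: there is a continuous
homomorphism `ℤ_π → A` with `1 ↦ a`, and it may be chosen additively in `a`. -/
theorem exists_piAdic_smul (π : Set Nat.Primes) (A : Type*) [AddCommGroup A] [Finite A]
    (hA : ∀ (a : A) (p : Nat.Primes), (p : ℕ) ∣ addOrderOf a → p ∈ π) :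
    ∃ σ : PiAdicInt π →+ A →+ A, IsLocallyConstant σ ∧ ∀ a, σ 1 a = a := by
  have hn : Nat.card A ≠ 0 := Nat.card_pos.ne'
  obtain ⟨θ, hθ, -⟩ := exists_reduction π hn (mem_of_dvd_card hA)
  let _ : Module (ZMod (Nat.card A)) A := AddCommGroup.zmodModule fun a => card_nsmul_eq_zero'
  refine ⟨(smulAddHom (ZMod (Nat.card A)) A).comp θ.toAddMonoidHom,
    hθ.comp (smulAddHom (ZMod (Nat.card A)) A), fun a => ?_⟩
  change θ 1 • a = a
  rw [map_one, one_smul]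

/-- A homomorphism from `ℤ_π` to a finite `π`-primary group is determined by its value at `1`,
even without a continuity assumption: it factors through the reduction modulo the order. -/
theorem piAdic_hom_eq_zero (π : Set Nat.Primes) (A : Type*) [AddCommGroup A] [Finite A]
    (hA : ∀ (a : A) (p : Nat.Primes), (p : ℕ) ∣ addOrderOf a → p ∈ π)
    (ψ : PiAdicInt π →+ A) (hψ : ψ 1 = 0) : ψ = 0 := by
  have hn : Nat.card A ≠ 0 := Nat.card_pos.ne'
  obtain ⟨θ, -, hθ⟩ := exists_reduction π hn (mem_of_dvd_card hA)
  ext r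
  obtain ⟨k, hk⟩ := ZMod.intCast_surjective (θ r)
  obtain ⟨t, ht⟩ := hθ (r - k • (1 : PiAdicInt π)) (by
    rw [map_sub, map_zsmul, map_one, ← hk]; simp)
  rw [sub_eq_iff_eq_add.1 ht, map_add, map_nsmul, map_zsmul, hψ, smul_zero, add_zero]
  exact card_nsmul_eq_zero'

/-! ### Homomorphisms on free profinite modules -/

namespace FreeProfinite

section General

variable {R : Type*} [CommRing R] {Y : Type*} [TopologicalSpace Y]

theorem coeff_dirac (y : Y) (Q : DiscreteQuotient Y) :
    coeff (dirac y : FreeProfinite R Y) Q = Finsupp.single (Q.proj y) 1 := rfl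

theorem coeff_smul (c : R) (m : FreeProfinite R Y) (Q : DiscreteQuotient Y) :
    coeff (c • m) Q = c • coeff m Q := rfl

theorem coeff_sub (a b : FreeProfinite R Y) (Q : DiscreteQuotient Y) :
    coeff (a - b) Q = coeff a Q - coeff b Q := rfl

/-- The coefficients at a fixed discrete quotient, as a homomorphism. -/
def coeffHom (Q : DiscreteQuotient Y) : FreeProfinite R Y →+ (Q →₀ R) where
  toFun m := coeff m Q
  map_zero' := rfl
  map_add' _ _ := rfl

variable [TopologicalSpace R]

theorem continuous_iff {T : Type*} [TopologicalSpace T] {f : T → FreeProfinite R Y} :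
    Continuous f ↔ ∀ (Q : DiscreteQuotient Y) (q : Q), Continuous fun t => coeff (f t) Q q := by
  refine ⟨fun h Q q => (continuous_coeff Q q).comp h, fun h => ?_⟩
  exact continuous_induced_rng.2 (continuous_pi fun z => h z.1 z.2)

theorem continuous_dirac : Continuous (dirac : Y → FreeProfinite R Y) := by
  classical
  refine continuous_iff.2 fun Q q => ?_
  have h : Continuous (fun z : Q => (Finsupp.single z (1 : R)) q) :=
    continuous_of_discreteTopology
  exact h.comp Q.proj_continuous

theorem continuous_sub [IsTopologicalRing R] {T : Type*} [TopologicalSpace T]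
    {f g : T → FreeProfinite R Y} (hf : Continuous f) (hg : Continuous g) :
    Continuous fun t => f t - g t :=
  continuous_iff.2 fun Q q => ((continuous_coeff Q q).comp hf).sub ((continuous_coeff Q q).comp hg)

theorem continuous_smul_const [IsTopologicalRing R] (m : FreeProfinite R Y) {T : Type*}
    [TopologicalSpace T] {c : T → R} (hc : Continuous c) : Continuous fun t => c t • m :=
  continuous_iff.2 fun _ _ => hc.mul continuous_const

theorem continuous_ev [IsTopologicalRing R] [CompactSpace Y] :
    Continuous (ev : FreeProfinite R Y → R) := by
  have := Fintype.ofFinite (⊤ : DiscreteQuotient Y)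
  refine (continuous_finsetSum Finset.univ
    fun q _ => continuous_coeff (R := R) (⊤ : DiscreteQuotient Y) q).congr fun m => ?_
  exact (Finsupp.sum_fintype (coeff m ⊤) (fun _ r => r) fun _ => rfl).symm

/-- On a compact space, a neighbourhood of `0` contains all elements whose coefficients vanish
at a suitable finite level. -/
theorem exists_coeff_eq_zero_subset (U : Set (FreeProfinite R Y)) (hU : U ∈ 𝓝 0) :
    ∃ Q : DiscreteQuotient Y, ∀ m, coeff m Q = 0 → m ∈ U := by
  rw [nhds_induced, Filter.mem_comap] at hU
  obtain ⟨V, hV, hVU⟩ := hU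
  rw [nhds_pi, Filter.mem_pi] at hV
  obtain ⟨I, hI, t, ht, htV⟩ := hV
  refine ⟨hI.toFinset.inf fun z => z.1, fun m hm => hVU (htV fun z hz => ?_)⟩
  have hle : hI.toFinset.inf (fun z => z.1) ≤ z.1 := Finset.inf_le (hI.mem_toFinset.2 hz)
  have h0 : coeff m z.1 = 0 := by
    rw [← coeff_compat m hle, hm, Finsupp.mapDomain_zero]
  change coeff m z.1 z.2 ∈ t z
  rw [h0]
  exact mem_of_mem_nhds (ht z)

end General

section PiAdic

variable {π : Set Nat.Primes} {Y : Type*} [TopologicalSpace Y]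
  {A : Type*} [AddCommGroup A] [TopologicalSpace A] [DiscreteTopology A] [Finite A]

/-- A continuous homomorphism to `A` is determined by its values on `Y`. -/
theorem contHom_ext (hA : ∀ (a : A) (p : Nat.Primes), (p : ℕ) ∣ addOrderOf a → p ∈ π)
    {φ ψ : ContHom (FreeProfinite (PiAdicInt π) Y) A}
    (h : ∀ y, φ (dirac y) = ψ (dirac y)) : φ = ψ := by
  suffices H : ∀ χ : ContHom (FreeProfinite (PiAdicInt π) Y) A,
      (∀ y, χ (dirac y) = 0) → ∀ m, χ m = 0 by
    refine ContHom.ext fun m => sub_eq_zero.1 ?_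
    exact H (φ - ψ) (fun y => sub_eq_zero.2 (h y)) m
  intro χ hχ m
  obtain ⟨Q, hQ⟩ := exists_coeff_eq_zero_subset (χ ⁻¹' {0})
    ((map_continuous χ).continuousAt.preimage_mem_nhds
      (by rw [map_zero]; exact (isOpen_discrete _).mem_nhds rfl))
  have hsmul : ∀ (c : PiAdicInt π) (y : Y), χ (c • dirac y) = 0 := by
    intro c y
    exact DFunLike.congr_fun (piAdic_hom_eq_zero π A hA
      ((χ : FreeProfinite (PiAdicInt π) Y →+ A).comp
        ((smulAddHom (PiAdicInt π) (FreeProfinite (PiAdicInt π) Y)).flip (dirac y)))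
      (by change χ ((1 : PiAdicInt π) • dirac y) = 0
          rw [one_smul]; exact hχ y)) c
  -- `m'` is a finite combination of points of `Y` with the same coefficients as `m` at level `Q`.
  let m' : FreeProfinite (PiAdicInt π) Y :=
    (coeff m Q).sum fun q c => c • dirac (Function.surjInv Q.proj_surjective q)
  have h1 : χ m' = 0 := by
    rw [map_finsuppSum]
    exact Finset.sum_eq_zero fun q _ => hsmul _ _
  have h2 : coeff (m - m') Q = 0 := by
    rw [coeff_sub, sub_eq_zero]
    have : coeff m' Q = (coeff m Q).sum fun q c => Finsupp.single q c := by
      change coeffHom Q m' = _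
      rw [map_finsuppSum]
      refine Finsupp.sum_congr fun q _ => ?_
      change coeff (coeff m Q q • dirac (R := PiAdicInt π) _) Q = _
      rw [coeff_smul, coeff_dirac, Function.surjInv_eq Q.proj_surjective q, Finsupp.smul_single,
        smul_eq_mul, mul_one]
    rw [this, Finsupp.sum_single]
  have h3 : χ (m - m') = 0 := hQ _ h2
  rwa [map_sub, h1, sub_zero] at h3

variable [CompactSpace Y]

/-- Every continuous map `Y → A` extends to a continuous homomorphism. -/
theorem exists_contHom (hA : ∀ (a : A) (p : Nat.Primes), (p : ℕ) ∣ addOrderOf a → p ∈ π)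
    (f : C(Y, A)) : ∃ φ : ContHom (FreeProfinite (PiAdicInt π) Y) A,
      ∀ y, φ (dirac y) = f y := by
  obtain ⟨σ, hσ, hσ1⟩ := exists_piAdic_smul π A hA
  have hf : IsLocallyConstant f := (IsLocallyConstant.iff_continuous _).2 f.continuous
  let Q : DiscreteQuotient Y := LocallyConstant.discreteQuotient ⟨f, hf⟩
  let fQ : Q → A := fun q => f (Function.surjInv Q.proj_surjective q)
  have hfQ : ∀ y, fQ (Q.proj y) = f y := fun y =>
    Quotient.exact (Function.surjInv_eq Q.proj_surjective (Q.proj y))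
  have := Fintype.ofFinite Q
  let φ : FreeProfinite (PiAdicInt π) Y →+ A :=
    (Finsupp.liftAddHom fun q => σ.flip (fQ q)).comp (coeffHom Q)
  have hφ : ∀ m, φ m = ∑ q, σ (coeff m Q q) (fQ q) := fun m =>
    Finsupp.sum_fintype _ _ fun q => map_zero (σ.flip (fQ q))
  have hc : Continuous φ := by
    refine (continuous_finsetSum Finset.univ fun q _ => ?_).congr fun m => (hφ m).symm
    exact (hσ.comp fun s : A →+ A => s (fQ q)).continuous.comp (continuous_coeff Q q)
  refine ⟨(⟨φ, hc⟩ : FreeProfinite (PiAdicInt π) Y →ₜ+ A), fun y => ?_⟩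
  change (Finsupp.single (Q.proj y) (1 : PiAdicInt π)).sum (fun q c => σ c (fQ q)) = f y
  rw [Finsupp.sum_single_index (by simp), hσ1, hfQ]

/-- The continuous homomorphism extending a continuous map `Y → A`. -/
def lift (hA : ∀ (a : A) (p : Nat.Primes), (p : ℕ) ∣ addOrderOf a → p ∈ π)
    (f : C(Y, A)) : ContHom (FreeProfinite (PiAdicInt π) Y) A :=
  (exists_contHom hA f).choose

theorem lift_dirac (hA : ∀ (a : A) (p : Nat.Primes), (p : ℕ) ∣ addOrderOf a → p ∈ π)
    (f : C(Y, A)) (y : Y) : lift hA f (dirac y) = f y :=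
  (exists_contHom hA f).choose_spec y

end PiAdic

end FreeProfinite

/-! ### Continuity in a parameter -/

/-- A continuous function on `T × Y` with `Y` compact is a locally constant family of functions
on `Y`, if its values are discrete. -/
theorem isLocallyConstant_curry {T Y A : Type*} [TopologicalSpace T] [TopologicalSpace Y]
    [CompactSpace Y] [TopologicalSpace A] [DiscreteTopology A] (f : C(T × Y, A)) :
    IsLocallyConstant f.curry := by
  rw [IsLocallyConstant.iff_eventually_eq]
  intro t
  have h : ∀ y ∈ (Set.univ : Set Y), ∀ᶠ z in 𝓝 (t, y), f (z.1, z.2) = f (t, z.2) := by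
    intro y _
    have h1 : ContinuousAt (fun z : T × Y => (f z, f (t, z.2))) (t, y) := by fun_prop
    exact h1.eventually (p := fun w : A × A => w.1 = w.2)
      ((isOpen_discrete {w : A × A | w.1 = w.2}).mem_nhds rfl)
  filter_upwards [isCompact_univ.eventually_forall_of_forall_eventually
    (P := fun s y => f (s, y) = f (t, y)) h] with s hs
  exact ContinuousMap.ext fun y => hs y trivial

theorem ContHom.continuous_uncurry {T M A : Type*} [TopologicalSpace T] [AddCommGroup M]
    [TopologicalSpace M] [AddCommGroup A] [TopologicalSpace A] {η : T → ContHom M A}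
    (hη : IsLocallyConstant η) : Continuous fun z : T × M => η z.1 z.2 := by
  rw [continuous_iff_continuousAt]
  rintro ⟨t, m⟩
  have h : ContinuousAt (fun z : T × M => η t z.2) (t, m) :=
    ((map_continuous (η t)).comp continuous_snd).continuousAt
  refine h.congr ?_
  filter_upwards [continuous_fst.continuousAt.eventually (hη.eventually_eq t)] with z hz
  rw [hz]

/-! ### Free actions of finite groups on profinite spaces -/

/-- A continuous free action of a finite group on a profinite space is trivial as a torsor: there
is a continuous equivariant map to the group.  Equivalently, there is a clopen fundamental
domain, which is glued from small ones by compactness. -/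
theorem exists_equivariant {A Z : Type*} [AddGroup A] [Finite A] [TopologicalSpace A]
    [DiscreteTopology A] [TopologicalSpace Z] [CompactSpace Z] [TotallySeparatedSpace Z]
    [AddAction A Z] [ContinuousConstVAdd A Z] (hfree : ∀ (a : A) (z : Z), a +ᵥ z = z → a = 0) :
    ∃ β : C(Z, A), ∀ a z, β (a +ᵥ z) = a + β z := by
  have hpre : ∀ (a : A) {D : Set Z}, IsClopen D → IsClopen {z | a +ᵥ z ∈ D} := fun a D hD =>
    hD.preimage (continuous_const_vadd a)
  have hsat : ∀ {D : Set Z}, IsClopen D → IsClopen {z | ∃ a : A, a +ᵥ z ∈ D} := by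
    intro D hD
    have : {z | ∃ a : A, a +ᵥ z ∈ D} = ⋃ a : A, {z | a +ᵥ z ∈ D} := by ext; simp
    rw [this]
    exact isClopen_iUnion_of_finite fun a => hpre a hD
  have key : ∃ D : Set Z, IsClopen D ∧ (∀ a : A, ∀ z ∈ D, a +ᵥ z ∈ D → a = 0) ∧
      (Set.univ : Set Z) ⊆ {z | ∃ a : A, a +ᵥ z ∈ D} := by
    refine isCompact_univ.induction_on (p := fun s => ∃ D : Set Z, IsClopen D ∧
      (∀ a : A, ∀ z ∈ D, a +ᵥ z ∈ D → a = 0) ∧ s ⊆ {z | ∃ a : A, a +ᵥ z ∈ D}) ?_ ?_ ?_ ?_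
    · exact ⟨∅, isClopen_empty, by simp, by simp⟩
    · rintro s t hst ⟨D, h1, h2, h3⟩
      exact ⟨D, h1, h2, hst.trans h3⟩
    · rintro s t ⟨D, h1, h2, h3⟩ ⟨D', h1', h2', h3'⟩
      refine ⟨D ∪ (D' \ {z | ∃ a : A, a +ᵥ z ∈ D}), h1.union (h1'.diff (hsat h1)), ?_, ?_⟩
      · rintro a z (hz | ⟨hz, hz'⟩) (ha | ⟨ha, ha'⟩)
        · exact h2 a z hz ha
        · exact (ha' ⟨-a, by rwa [neg_vadd_vadd]⟩).elim
        · exact (hz' ⟨a, ha⟩).elim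
        · exact h2' a z hz ha
      · rintro z (hz | hz)
        · obtain ⟨a, ha⟩ := h3 hz
          exact ⟨a, Or.inl ha⟩
        · obtain ⟨a, ha⟩ := h3' hz
          by_cases h : ∃ b : A, b +ᵥ z ∈ D
          · obtain ⟨b, hb⟩ := h
            exact ⟨b, Or.inl hb⟩
          · refine ⟨a, Or.inr ⟨ha, ?_⟩⟩
            rintro ⟨b, hb⟩
            exact h ⟨b + a, by rwa [add_vadd]⟩
    · intro z _
      have h : ∀ a : A, ∃ U : Set Z, IsClopen U ∧ z ∈ U ∧ (a ≠ 0 → a +ᵥ z ∉ U) := by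
        intro a
        by_cases ha : a = 0
        · exact ⟨Set.univ, isClopen_univ, trivial, fun h => (h ha).elim⟩
        · obtain ⟨U, hU, hz, hz'⟩ := exists_isClopen_of_totally_separated
            (fun h => ha (hfree a z h.symm) : z ≠ a +ᵥ z)
          exact ⟨U, hU, hz, fun _ => hz'⟩
      choose U hU hzU hz' using h
      let D : Set Z := ⋂ a : A, {w | w ∈ U a ∧ (a ≠ 0 → a +ᵥ w ∉ U a)}
      have hD : IsClopen D := by
        refine isClopen_iInter_of_finite fun a => ?_
        by_cases ha : a = 0
        · simpa [ha] using hU 0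
        · simp only [ne_eq, ha, not_false_eq_true, forall_const]
          exact (hU a).inter (hpre a (hU a)).compl
      have hzD : z ∈ D := Set.mem_iInter.2 fun a => ⟨hzU a, hz' a⟩
      refine ⟨D, mem_nhdsWithin_of_mem_nhds (hD.isOpen.mem_nhds hzD), D, hD, ?_, ?_⟩
      · intro a w hw haw
        by_contra ha
        exact (Set.mem_iInter.1 hw a).2 ha (Set.mem_iInter.1 haw a).1
      · exact fun w hw => ⟨0, by simpa using hw⟩
  obtain ⟨D, hD, hD1, hD2⟩ := key
  choose c hc using fun z => hD2 (Set.mem_univ z)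
  have huniq : ∀ (z : Z) (a : A), a +ᵥ z ∈ D → c z = a := by
    intro z a ha
    have h := hD1 (c z - a) (a +ᵥ z) ha (by rw [← add_vadd, sub_add_cancel]; exact hc z)
    exact sub_eq_zero.1 h
  refine ⟨⟨fun z => -c z, ?_⟩, fun a z => ?_⟩
  · refine Continuous.neg (continuous_discrete_rng.2 fun b => ?_)
    have : c ⁻¹' {b} = {z | b +ᵥ z ∈ D} := by
      ext z
      exact ⟨fun h => by rw [← (h : c z = b)]; exact hc z, fun h => huniq z b h⟩
    rw [this]
    exact (hpre b hD).isOpen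
  · change -c (a +ᵥ z) = a + -c z
    rw [huniq (a +ᵥ z) (c z + -a) (by rw [add_vadd, neg_vadd_vadd]; exact hc z)]
    simp

/-! ### The space of cosets -/

namespace ProfiniteGroupPair

variable (P : ProfiniteGroupPair.{u, v})

theorem isQuotientMap_coset :
    IsQuotientMap fun z : P.G × P.X => P.coset z.1 z.2 :=
  isQuotientMap_quotient_mk'

theorem continuous_coset : Continuous fun z : P.G × P.X => P.coset z.1 z.2 :=
  P.isQuotientMap_coset.continuous

variable {P} in
theorem coset_eq_iff {g h : P.G} {x y : P.X} :
    P.coset g x = P.coset h y ↔ x = y ∧ g⁻¹ * h ∈ P.S x :=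
  ⟨fun e => Quotient.exact e, fun e => Quotient.sound e⟩

variable {P} in
theorem exists_coset (y : P.Cosets) : ∃ g x, P.coset g x = y := by
  obtain ⟨⟨g, x⟩, h⟩ := P.isQuotientMap_coset.surjective y
  exact ⟨g, x, h⟩

theorem translate_coset (g k : P.G) (x : P.X) :
    P.translate g (P.coset k x) = P.coset (g * k) x := rfl

theorem coset_mul_mem (g : P.G) {s : P.G} {x : P.X} (hs : s ∈ P.S x) :
    P.coset (g * s) x = P.coset g x := by
  rw [eq_comm, coset_eq_iff]
  exact ⟨rfl, by simpa using hs⟩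

/-- The projection from `G/S` to the index space. -/
def index : C(P.Cosets, P.X) where
  toFun := Quotient.lift (fun z => z.2) fun _ _ h => h.1
  continuous_toFun := continuous_snd.quotient_lift _

theorem index_coset (g : P.G) (x : P.X) : P.index (P.coset g x) = x := rfl

theorem index_translate (g : P.G) (y : P.Cosets) : P.index (P.translate g y) = P.index y := by
  obtain ⟨k, x, rfl⟩ := exists_coset y
  rfl

instance : CompactSpace P.Cosets :=
  inferInstanceAs (CompactSpace (Quotient P.cosetSetoid))

instance : Nonempty P.Cosets := ⟨P.coset 1 P.nonempty.some⟩

theorem isClosed_S (x : P.X) : IsClosed (P.S x : Set P.G) :=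
  P.isClosed_family.preimage (Continuous.prodMk_left x)

/-- Semicontinuity of the family of subgroups. -/
theorem isOpen_setOf_S_le (H : Subgroup P.G) (hH : IsOpen (H : Set P.G)) :
    IsOpen {x | P.S x ≤ H} := by
  have h : IsClosed (Prod.snd '' ({z : P.G × P.X | z.1 ∈ P.S z.2} ∩ {z | z.1 ∉ H})) :=
    isClosedMap_snd_of_compactSpace _
      (P.isClosed_family.inter (hH.isClosed_compl.preimage continuous_fst))
  convert h.isOpen_compl using 1
  ext x
  simp [SetLike.le_def]

/-- `G/S` is a profinite space.  Two cosets of the same `S x` are separated by a set of the form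
`{k (S z) | z ∈ V, k ∈ g (S x) U}` with `U` an open normal subgroup and `V` a clopen neighbourhood
of `x` on which `S z ⊆ (S x) U`. -/
instance : TotallySeparatedSpace P.Cosets := by
  rw [totallySeparatedSpace_iff_exists_isClopen]
  intro y y' hne
  obtain ⟨g, x, rfl⟩ := exists_coset y
  obtain ⟨g', x', rfl⟩ := exists_coset y'
  by_cases hx : x = x'
  · subst hx
    have hg : g⁻¹ * g' ∉ P.S x := fun h => hne (coset_eq_iff.2 ⟨rfl, h⟩)
    obtain ⟨U, hU⟩ := ProfiniteGrp.exist_openNormalSubgroup_sub_open_nhds_of_one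
      (U := {w : P.G | g⁻¹ * g' * w⁻¹ ∉ P.S x})
      ((P.isClosed_S x).isOpen_compl.preimage (by fun_prop)) (by simpa using hg)
    let H : Subgroup P.G := P.S x ⊔ U.toSubgroup
    have hH : IsOpen (H : Set P.G) := Subgroup.isOpen_mono le_sup_right U.isOpen
    have hHc : IsClopen (H : Set P.G) := ⟨Subgroup.isClosed_of_isOpen H hH, hH⟩
    obtain ⟨V, hV, hxV, hVH⟩ := compact_exists_isClopen_in_isOpen (P.isOpen_setOf_S_le H hH)
      (le_sup_left : P.S x ≤ H)
    let C : Set (P.G × P.X) := {z | z.2 ∈ V ∧ g⁻¹ * z.1 ∈ H}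
    have hC : IsClopen C := (hV.preimage continuous_snd).inter
      (hHc.preimage (f := fun z : P.G × P.X => g⁻¹ * z.1) (by fun_prop))
    have hpre : ∀ k z, P.coset k z ∈ (fun z : P.G × P.X => P.coset z.1 z.2) '' C ↔
        (k, z) ∈ C := by
      refine fun k z => ⟨?_, fun h => ⟨(k, z), h, rfl⟩⟩
      rintro ⟨⟨k', z'⟩, ⟨h1, h2⟩, h3⟩
      obtain ⟨rfl, h4⟩ := coset_eq_iff.1 h3
      refine ⟨h1, ?_⟩
      have := H.mul_mem h2 (hVH h1 h4)
      simpa [mul_assoc] using this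
    refine ⟨(fun z : P.G × P.X => P.coset z.1 z.2) '' C, ?_, (hpre _ _).2 ⟨hxV, by simp⟩, ?_⟩
    · rw [← P.isQuotientMap_coset.isClopen_preimage]
      convert hC using 1
      ext ⟨k, z⟩
      exact hpre k z
    · intro hmem
      obtain ⟨-, h2⟩ := (hpre _ _).1 hmem
      obtain ⟨s, hs, w, hw, hsw⟩ := Subgroup.mem_sup_of_normal_right.1 h2
      refine hU hw ?_
      rw [← hsw]
      simpa using hs
  · obtain ⟨V, hV, hxV, hxV'⟩ := exists_isClopen_of_totally_separated hx
    exact ⟨P.index ⁻¹' V, hV.preimage P.index.continuous, hxV, hxV'⟩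

/-- The action of `G` on `G/S` is jointly continuous. -/
theorem continuous_translate : Continuous fun z : P.G × P.Cosets => P.translate z.1 z.2 := by
  have hq : IsQuotientMap (Prod.map id fun z : P.G × P.X => P.coset z.1 z.2 :
      P.G × P.G × P.X → P.G × P.Cosets) :=
    IsQuotientMap.of_surjective_continuous
      (Function.surjective_id.prodMap P.isQuotientMap_coset.surjective)
      (continuous_id.prodMap P.continuous_coset)
  rw [hq.continuous_iff]
  exact P.continuous_coset.comp
    (f := fun z : P.G × P.G × P.X => (z.1 * z.2.1, z.2.2)) (by fun_prop)

end ProfiniteGroupPair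

/-! ### Homomorphisms on the permutation module and on the augmentation kernel -/

variable {π : Set Nat.Primes} {P : ProfiniteGroupPair.{u, v}} {M : FiniteModule.{u, w} π P.G}

namespace ProfiniteGroupPair

theorem smul_hom_dirac (g : P.G) (φ : ContHom (P.PermModule π) M.A) (y : P.Cosets) :
    (g • φ) (FreeProfinite.dirac y) = g • φ (FreeProfinite.dirac (P.translate g⁻¹ y)) := by
  rw [ContHom.smul_apply, smul_def, FreeProfinite.map_dirac]

/-- Restriction of homomorphisms to `Δ`. -/
def res : ContHom (P.PermModule π) M.A →+ ContHom (P.Delta π) M.A where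
  toFun φ := (⟨(φ : P.PermModule π →+ M.A).comp Delta.inc,
    (map_continuous φ).comp (Delta.continuous_inc P π)⟩ : P.Delta π →ₜ+ M.A)
  map_zero' := rfl
  map_add' _ _ := rfl

theorem res_smul (g : P.G) (φ : ContHom (P.PermModule π) M.A) : res (g • φ) = g • res φ := rfl

/-- The homomorphisms which are constant on `G/S` are the multiples of the augmentation, so they
vanish on `Δ`. -/
theorem res_eq_zero_of_const {φ : ContHom (P.PermModule π) M.A} {a : M.A}
    (h : ∀ y, φ (FreeProfinite.dirac y) = a) : res φ = 0 := by
  obtain ⟨σ, hσ, hσ1⟩ := exists_piAdic_smul π M.A M.primary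
  let ψ : P.PermModule π →ₜ+ M.A :=
    ⟨(σ.flip a).comp (FreeProfinite.ev : P.PermModule π →ₗ[PiAdicInt π] _).toAddMonoidHom,
      (hσ.comp fun s : M.A →+ M.A => s a).continuous.comp FreeProfinite.continuous_ev⟩
  have hφ : φ = (ψ : ContHom (P.PermModule π) M.A) := by
    refine FreeProfinite.contHom_ext M.primary fun y => (h y).trans ?_
    change a = σ (FreeProfinite.ev (FreeProfinite.dirac y)) a
    rw [FreeProfinite.ev_dirac, hσ1]
  refine ContHom.ext fun δ => ?_
  rw [hφ]
  change σ (FreeProfinite.ev δ.1) a = 0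
  rw [LinearMap.mem_ker.1 δ.2, map_zero]
  rfl

theorem const_of_res_eq_zero {φ : ContHom (P.PermModule π) M.A} (h : res φ = 0)
    (y y' : P.Cosets) : φ (FreeProfinite.dirac y) = φ (FreeProfinite.dirac y') := by
  let δ : P.Delta π := (⟨FreeProfinite.dirac y - FreeProfinite.dirac y', by
    rw [LinearMap.mem_ker, map_sub, FreeProfinite.ev_dirac, FreeProfinite.ev_dirac,
      sub_self]⟩ : LinearMap.ker _)
  rw [← sub_eq_zero, ← map_sub]
  exact DFunLike.congr_fun h δ

/-- Homomorphisms on `Δ` extend, since a point of `G/S` splits the augmentation. -/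
theorem res_surjective : Function.Surjective
    (res : ContHom (P.PermModule π) M.A →+ ContHom (P.Delta π) M.A) := by
  intro ω
  let d : P.PermModule π := FreeProfinite.dirac (Classical.arbitrary P.Cosets)
  have hd : FreeProfinite.ev d = 1 := FreeProfinite.ev_dirac _
  let ρ : P.PermModule π →ₗ[PiAdicInt π] LinearMap.ker
      (FreeProfinite.ev : P.PermModule π →ₗ[PiAdicInt π] PiAdicInt π) :=
    (LinearMap.id - (FreeProfinite.ev).smulRight d).codRestrict _ fun m => by
      rw [LinearMap.mem_ker, LinearMap.sub_apply, map_sub, LinearMap.id_apply,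
        LinearMap.smulRight_apply, map_smul, hd, smul_eq_mul, mul_one, sub_self]
  have hρ : Continuous ρ := Continuous.subtype_mk (FreeProfinite.continuous_sub continuous_id
    (FreeProfinite.continuous_smul_const d FreeProfinite.continuous_ev)) _
  refine ⟨(⟨(ω : P.Delta π →+ M.A).comp ρ.toAddMonoidHom,
    (map_continuous ω).comp hρ⟩ : P.PermModule π →ₜ+ M.A), ContHom.ext fun δ => ?_⟩
  change ω (ρ δ.1) = ω δ
  congr 1
  refine Subtype.ext ?_
  change δ.1 - FreeProfinite.ev δ.1 • d = δ.1
  rw [LinearMap.mem_ker.1 δ.2, zero_smul, sub_zero]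

end ProfiniteGroupPair

open ProfiniteGroupPair

/-! ### Relative cochains -/

/-- A continuous cochain `u : G → C(G/S, A)`, written as a function of two variables, whose
coboundary takes values `ζ (g, h)` in the constant functions.  As
`C(G/S, A) = Hom(ℤ_π⟦G/S⟧, A)` and the constant functions are the kernel of the restriction
to `Δ`, such cochains restrict to the cocycles `G → Hom(Δ, A)`. -/
structure RelCochain (P : ProfiniteGroupPair.{u, v}) (M : FiniteModule.{u, w} π P.G) where
  /-- the cochain -/
  u : C(P.G × P.Cosets, M.A)
  /-- the values of the coboundary -/
  ζ : P.G → P.G → M.A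
  coboundary : ∀ (g h : P.G) (y : P.Cosets),
    g • u (h, P.translate g⁻¹ y) - u (g * h, y) + u (g, y) = ζ g h

namespace RelCochain

variable (k : RelCochain P M)

/-- The cochain with values in `Hom(ℤ_π⟦G/S⟧, A)`. -/
def hom (g : P.G) : ContHom (P.PermModule π) M.A :=
  FreeProfinite.lift M.primary (k.u.curry g)

theorem hom_dirac (g : P.G) (y : P.Cosets) : k.hom g (FreeProfinite.dirac y) = k.u (g, y) :=
  FreeProfinite.lift_dirac _ _ _

theorem isLocallyConstant_hom : IsLocallyConstant k.hom :=
  (isLocallyConstant_curry k.u).comp (FreeProfinite.lift M.primary)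

theorem coboundary_hom (g h : P.G) (y : P.Cosets) :
    (g • k.hom h - k.hom (g * h) + k.hom g) (FreeProfinite.dirac y) = k.ζ g h := by
  change (g • k.hom h) _ - k.hom (g * h) _ + k.hom g _ = _
  rw [smul_hom_dirac, hom_dirac, hom_dirac, hom_dirac, k.coboundary]

/-- The associated cocycle with values in `Hom(Δ, A)`. -/
def cocycle : contZ1 P.G (ContHom (P.Delta π) M.A) :=
  ⟨fun g => res (k.hom g), k.isLocallyConstant_hom.comp res, fun g h => by
    have := res_eq_zero_of_const (k.coboundary_hom g h)
    rw [map_add, map_sub, res_smul] at this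
    rw [← sub_eq_zero, ← neg_eq_zero, ← this]
    abel⟩

/-- The class of a relative cochain in the relative cohomology group. -/
def cls : RelH2 P M := ContH1.mk k.cocycle

/-- Two relative cochains have the same class iff they differ by the coboundary of a function
on `G/S`, up to a cochain with values in the constant functions. -/
theorem cls_eq_iff (k k' : RelCochain P M) : k.cls = k'.cls ↔
    ∃ (ω : C(P.Cosets, M.A)) (b : C(P.G, M.A)), ∀ g y,
      k'.u (g, y) = k.u (g, y) + (g • ω (P.translate g⁻¹ y) - ω y) + b g := by
  have h1 : k.cls = k'.cls ↔ ∃ ω : ContHom (P.Delta π) M.A,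
      ∀ g, -res (k.hom g) + res (k'.hom g) = g • ω - ω :=
    QuotientAddGroup.eq
  rw [h1]
  constructor
  · rintro ⟨ω, hω⟩
    obtain ⟨ψ, rfl⟩ := res_surjective ω
    have h2 : ∀ g, res (k'.hom g - k.hom g - (g • ψ - ψ)) = 0 := by
      intro g
      rw [map_sub, map_sub, map_sub, res_smul, ← hω g]
      abel
    refine ⟨⟨fun y => ψ (FreeProfinite.dirac y),
      (map_continuous ψ).comp FreeProfinite.continuous_dirac⟩,
      ⟨fun g => k'.u (g, P.coset 1 P.nonempty.some) - k.u (g, P.coset 1 P.nonempty.some) -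
        (g • ψ (FreeProfinite.dirac (P.translate g⁻¹ (P.coset 1 P.nonempty.some))) -
          ψ (FreeProfinite.dirac (P.coset 1 P.nonempty.some))), ?_⟩, fun g y => ?_⟩
    · have h3 : Continuous fun g : P.G => ψ (FreeProfinite.dirac
          (P.translate g⁻¹ (P.coset 1 P.nonempty.some))) :=
        (map_continuous ψ).comp (FreeProfinite.continuous_dirac.comp
          (P.continuous_translate.comp (continuous_inv.prodMk continuous_const)))
      have h4 : Continuous fun g : P.G => (g, P.coset 1 P.nonempty.some) := by fun_prop
      exact ((k'.u.continuous.comp h4).sub (k.u.continuous.comp h4)).sub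
        ((continuous_id.smul h3).sub continuous_const)
    · have h3 := const_of_res_eq_zero (h2 g) y (P.coset 1 P.nonempty.some)
      change k'.hom g _ - k.hom g _ - ((g • ψ) _ - ψ _) =
        k'.hom g _ - k.hom g _ - ((g • ψ) _ - ψ _) at h3
      simp only [hom_dirac, smul_hom_dirac] at h3
      change k'.u (g, y) = k.u (g, y) + (g • ψ _ - ψ _) + (_ - _ - (g • ψ _ - ψ _))
      rw [← h3]
      abel
  · rintro ⟨ω, b, h⟩
    refine ⟨res (FreeProfinite.lift M.primary ω), fun g => ?_⟩
    have h2 : res (k'.hom g - k.hom g - (g • FreeProfinite.lift M.primary ω -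
        FreeProfinite.lift M.primary ω)) = 0 := by
      refine res_eq_zero_of_const (a := b g) fun y => ?_
      change k'.hom g _ - k.hom g _ - ((g • FreeProfinite.lift M.primary ω) _ -
        FreeProfinite.lift M.primary ω _) = _
      rw [smul_hom_dirac, hom_dirac, hom_dirac, FreeProfinite.lift_dirac,
        FreeProfinite.lift_dirac, h]
      abel
    rw [map_sub, map_sub, map_sub, res_smul, sub_eq_zero] at h2
    rw [← h2]
    abel

/-- A cochain `η` with values in `Hom(ℤ_π⟦G/S⟧, A)` and with coboundary in the constant
functions, as a relative cochain. -/
def ofHom (η : P.G → ContHom (P.PermModule π) M.A) (hη : IsLocallyConstant η)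
    (ζ : P.G → P.G → M.A)
    (h : ∀ (g h : P.G) (y : P.Cosets),
      (g • η h - η (g * h) + η g) (FreeProfinite.dirac y) = ζ g h) : RelCochain P M where
  u := ⟨fun z => η z.1 (FreeProfinite.dirac z.2), (ContHom.continuous_uncurry hη).comp
    (continuous_fst.prodMk (FreeProfinite.continuous_dirac.comp continuous_snd))⟩
  ζ := ζ
  coboundary g g' y := by
    refine Eq.trans ?_ (h g g' y)
    exact congrArg (fun a => a - η (g * g') (FreeProfinite.dirac y) + η g (FreeProfinite.dirac y))
      (smul_hom_dirac g (η g') y).symm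

theorem hom_ofHom (η : P.G → ContHom (P.PermModule π) M.A) (hη : IsLocallyConstant η)
    (ζ : P.G → P.G → M.A)
    (h : ∀ (g h : P.G) (y : P.Cosets),
      (g • η h - η (g * h) + η g) (FreeProfinite.dirac y) = ζ g h) :
    (ofHom η hη ζ h).hom = η :=
  funext fun g => FreeProfinite.contHom_ext M.primary fun y => hom_dirac _ g y

/-- Every class is represented by a relative cochain. -/
theorem exists_cls_eq (c : RelH2 P M) : ∃ k : RelCochain P M, k.cls = c := by
  obtain ⟨ξ, rfl⟩ := QuotientAddGroup.mk'_surjective _ c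
  choose s hs using res_surjective (P := P) (M := M)
  have hcob : ∀ (g h : P.G), res (g • s (ξ.1 h) - s (ξ.1 (g * h)) + s (ξ.1 g)) = 0 := by
    intro g h
    rw [map_add, map_sub, res_smul, hs, hs, hs, ξ.2.2 g h]
    abel
  refine ⟨ofHom (fun g => s (ξ.1 g)) (ξ.2.1.comp s)
    (fun g h => (g • s (ξ.1 h) - s (ξ.1 (g * h)) + s (ξ.1 g))
      (FreeProfinite.dirac (P.coset 1 P.nonempty.some)))
    fun g h y => const_of_res_eq_zero (hcob g h) _ _,
    congrArg ContH1.mk (Subtype.ext (funext fun g => ?_))⟩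
  refine Eq.trans ?_ (hs (ξ.1 g))
  exact congrArg res (congrFun (hom_ofHom _ _ _ _) g)

/-- The relative extension `X` is described by the relative cochain `k` and the section `r`: the
factor set of `r` is the coboundary of `k`, and `r` differs from the splittings by the values
of `k` at the trivial cosets. -/
structure Realizes (k : RelCochain P M) (X : RelExt P M) (r : P.G → X.E) : Prop where
  continuous : Continuous r
  p_apply : ∀ g, X.p (r g) = g
  mul : ∀ g h, r g * r h = X.ι (k.ζ g h) * r (g * h)
  q_apply : ∀ (x : P.X) (s : P.S x), X.q x s = X.ι (-k.u (s, P.coset 1 x)) * r s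

theorem corresponds_iff {c : RelH2 P M} {X : RelExt P M} :
    Corresponds c X ↔ ∃ (k : RelCochain P M) (r : P.G → X.E), k.cls = c ∧ k.Realizes X r := by
  constructor
  · rintro ⟨ξ, η, ζ, r, rfl, hη, hξ, hr, hr1, hζ, hr2, hq⟩
    refine ⟨ofHom η hη ζ hζ, r, congrArg ContH1.mk (Subtype.ext (funext fun g => ?_)),
      ⟨hr, hr1, hr2, hq⟩⟩
    change res ((ofHom η hη ζ hζ).hom g) = ξ.1 g
    rw [hom_ofHom]
    exact ContHom.ext (hξ g)
  · rintro ⟨k, r, rfl, h⟩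
    exact ⟨k.cocycle, k.hom, k.ζ, r, rfl, k.isLocallyConstant_hom, fun g δ => rfl, h.continuous,
      h.p_apply, k.coboundary_hom, h.mul, fun x s => by rw [hom_dirac]; exact h.q_apply x s⟩

end RelCochain

/-! ### Calculus in extensions -/

namespace ProfiniteGroupPair

/-- Continuous functions on `G × X` which are right invariant under the `S x` descend to `G/S`. -/
theorem exists_descent (P : ProfiniteGroupPair.{u, v}) {T : Type*} [TopologicalSpace T]
    (f : C(P.G × P.X, T)) (hf : ∀ g x, ∀ s ∈ P.S x, f (g * s, x) = f (g, x)) :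
    ∃ F : C(P.Cosets, T), ∀ g x, F (P.coset g x) = f (g, x) := by
  refine ⟨⟨Quotient.lift f ?_, f.continuous.quotient_lift _⟩, fun _ _ => rfl⟩
  rintro ⟨g, x⟩ ⟨h, y⟩ ⟨e, hs⟩
  obtain rfl : x = y := e
  rw [← hf g x _ hs, mul_inv_cancel_left]

end ProfiniteGroupPair

namespace RelExt

variable (X : RelExt P M)

theorem ι_injective : Function.Injective X.ι :=
  X.ext.inl_injective.comp Multiplicative.ofAdd.injective

theorem p_ι (a : M.A) : X.p (X.ι a) = 1 := X.ext.rightHom_inl _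

theorem p_surjective : Function.Surjective X.p := X.ext.rightHom_surjective

theorem p_q (x : P.X) (s : P.S x) : X.p (X.q x s) = s := X.rightHom_q x s

theorem exists_ι_eq {e : X.E} (he : X.p e = 1) : ∃ a, X.ι a = e := by
  have h : e ∈ X.ext.inl.range := by
    rw [X.ext.range_inl_eq_ker_rightHom]
    exact he
  obtain ⟨a, ha⟩ := h
  exact ⟨a.toAdd, ha⟩

theorem exists_ι_mul_eq {e e' : X.E} (h : X.p e = X.p e') : ∃ a, X.ι a * e' = e := by
  obtain ⟨a, ha⟩ := X.exists_ι_eq (e := e * e'⁻¹) (by rw [map_mul, map_inv, h, mul_inv_cancel])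
  exact ⟨a, by rw [ha, inv_mul_cancel_right]⟩

theorem mul_ι (e : X.E) (a : M.A) : e * X.ι a = X.ι (X.p e • a) * e :=
  mul_inv_eq_iff_eq_mul.1 (X.conj_inl e a)

theorem ι_mul_mul_ι_mul (a b : M.A) (e e' : X.E) :
    X.ι a * e * (X.ι b * e') = X.ι (a + X.p e • b) * (e * e') := by
  rw [ι_add, mul_assoc, ← mul_assoc e, mul_ι]
  simp only [mul_assoc]

theorem ι_mul_ι_mul (a b : M.A) (e : X.E) : X.ι a * (X.ι b * e) = X.ι (a + b) * e := by
  rw [ι_add, mul_assoc]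

theorem conj_ι_mul (a b : M.A) (e : X.E) :
    X.ι a * (X.ι b * e) * (X.ι a)⁻¹ = X.ι (a + b - X.p e • a) * e := by
  rw [← ι_neg, mul_assoc, mul_assoc, mul_ι, ι_mul_ι_mul, ι_mul_ι_mul, smul_neg]
  congr 2
  abel

theorem ι_mul_right_injective {a b : M.A} {e : X.E} (h : X.ι a * e = X.ι b * e) : a = b :=
  X.ι_injective (mul_right_cancel h)

theorem continuous_ι : Continuous X.ι := continuous_of_discreteTopology

theorem continuous_of_ι {T : Type*} [TopologicalSpace T] {c : T → M.A}
    (h : Continuous fun t => X.ι (c t)) : Continuous c :=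
  (X.continuous_ι.isClosedEmbedding X.ι_injective).isInducing.continuous_iff.2 h

end RelExt

/-! ### Uniqueness of the class of a relative extension -/

namespace RelCochain

theorem Realizes.apply_one {k : RelCochain P M} {X : RelExt P M} {r : P.G → X.E}
    (h : k.Realizes X r) : r 1 = X.ι (k.ζ 1 1) := by
  have := h.mul 1 1
  rw [mul_one] at this
  exact mul_right_cancel this

/-- Two relative cochains describing the same relative extension have the same class.  Up to
the difference of the sections, their difference is a cocycle `δ` with values in `C(G/S, A)` with
`δ s (S x) = 0` for `s ∈ S x`, and hence the coboundary of `g (S x) ↦ - δ g (g (S x))`. -/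
theorem Realizes.cls_eq {k k' : RelCochain P M} {X : RelExt P M} {r r' : P.G → X.E}
    (h : k.Realizes X r) (h' : k'.Realizes X r') : k.cls = k'.cls := by
  choose b hb using fun g => X.exists_ι_mul_eq ((h'.p_apply g).trans (h.p_apply g).symm)
  have hbc : Continuous b := X.continuous_of_ι <| by
    have : (fun g => X.ι (b g)) = fun g => r' g * (r g)⁻¹ :=
      funext fun g => eq_mul_inv_of_mul_eq (hb g)
    rw [this]
    exact h'.continuous.mul h.continuous.inv
  have hζ : ∀ g g', k'.ζ g g' + b (g * g') = b g + g • b g' + k.ζ g g' := by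
    intro g g'
    have h1 := h'.mul g g'
    rw [← hb, ← hb, ← hb, X.ι_mul_mul_ι_mul, h.p_apply, h.mul, X.ι_mul_ι_mul, X.ι_mul_ι_mul] at h1
    exact (X.ι_mul_right_injective h1).symm
  have hq : ∀ (x : P.X) (s : P.S x),
      k'.u (s, P.coset 1 x) = k.u (s, P.coset 1 x) + b s := by
    intro x s
    have h1 := (h.q_apply x s).symm.trans (h'.q_apply x s)
    rw [← hb, X.ι_mul_ι_mul] at h1
    rw [neg_eq_iff_eq_neg.1 (X.ι_mul_right_injective h1)]
    abel
  let δ : C(P.G × P.Cosets, M.A) := ⟨fun z => k'.u z - k.u z - b z.1,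
    (k'.u.continuous.sub k.u.continuous).sub (hbc.comp continuous_fst)⟩
  have hδ : ∀ g g' y, δ (g * g', y) = δ (g, y) + g • δ (g', P.translate g⁻¹ y) := by
    intro g g' y
    change k'.u (g * g', y) - k.u (g * g', y) - b (g * g') = k'.u (g, y) - k.u (g, y) - b g +
      g • (k'.u (g', P.translate g⁻¹ y) - k.u (g', P.translate g⁻¹ y) - b g')
    have h1 := hζ g g'
    rw [← k.coboundary g g' y, ← k'.coboundary g g' y] at h1
    rw [smul_sub, smul_sub, ← sub_eq_zero]
    rw [← sub_eq_zero] at h1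
    rw [← neg_eq_zero, ← h1]
    abel
  have hδS : ∀ x, ∀ s ∈ P.S x, δ (s, P.coset 1 x) = 0 := by
    intro x s hs
    change k'.u _ - k.u _ - b s = 0
    rw [hq x ⟨s, hs⟩]
    abel
  obtain ⟨ω, hω⟩ := P.exists_descent
    (-(δ.comp ⟨fun z => (z.1, P.coset z.1 z.2), continuous_fst.prodMk P.continuous_coset⟩)) <| by
    intro g x s hs
    change -δ (g * s, P.coset (g * s) x) = -δ (g, P.coset g x)
    rw [P.coset_mul_mem g hs, hδ, translate_coset, inv_mul_cancel, hδS x s hs, smul_zero, add_zero]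
  refine (cls_eq_iff k k').2 ⟨ω, ⟨b, hbc⟩, fun g y => ?_⟩
  obtain ⟨l, x, rfl⟩ := exists_coset y
  rw [translate_coset, hω, hω]
  change _ = k.u (g, P.coset l x) + (g • (-δ (g⁻¹ * l, P.coset (g⁻¹ * l) x)) -
    (-δ (l, P.coset l x))) + b g
  have h1 := hδ g (g⁻¹ * l) (P.coset l x)
  rw [mul_inv_cancel_left, translate_coset] at h1
  rw [h1]
  change _ = k.u (g, P.coset l x) + (_ - (-(k'.u (g, P.coset l x) - k.u (g, P.coset l x) - b g + _)))
    + b g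
  rw [smul_neg]
  abel

end RelCochain

/-! ### Functoriality -/

namespace DataHom

variable {P' : ProfiniteGroupPair.{u, v}} {M' : FiniteModule.{u, w} π P'.G}
  (m : DataHom P M P' M')

theorem cosetMap_coset (g : P'.G) (x : P'.X) :
    m.cosetMap (P'.coset g x) = P.coset (m.α g) (m.f x) := rfl

theorem cosetMap_translate (g : P'.G) (y : P'.Cosets) :
    m.cosetMap (P'.translate g y) = P.translate (m.α g) (m.cosetMap y) :=
  DFunLike.congr_fun (m.cosetMap_comp_translate g) y

/-- The image of a relative cochain. -/
def mapCochain (k : RelCochain P M) : RelCochain P' M' where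
  u := ⟨fun z => m.φ (k.u (m.α z.1, m.cosetMap z.2)),
    (continuous_of_discreteTopology (f := m.φ)).comp (k.u.continuous.comp
      (((map_continuous m.α).comp continuous_fst).prodMk
        (m.cosetMap.continuous.comp continuous_snd)))⟩
  ζ g h := m.φ (k.ζ (m.α g) (m.α h))
  coboundary g h y := by
    rw [← k.coboundary (m.α g) (m.α h) (m.cosetMap y), map_add, map_sub, m.map_smul, ← map_inv,
      ← map_mul, ← cosetMap_translate]
    rfl

theorem mapCochain_u (k : RelCochain P M) (g : P'.G) (y : P'.Cosets) :
    (m.mapCochain k).u (g, y) = m.φ (k.u (m.α g, m.cosetMap y)) := rfl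

theorem mapH2_cls (k : RelCochain P M) : m.mapH2 k.cls = (m.mapCochain k).cls := by
  refine congrArg ContH1.mk (Subtype.ext (funext fun g => ContHom.ext fun δ => ?_))
  let ψ : P'.PermModule π →ₜ+ M'.A := ⟨m.φ.comp ((k.hom (m.α g) : P.PermModule π →+ M.A).comp
      (FreeProfinite.map m.cosetMap : P'.PermModule π →ₗ[PiAdicInt π] _).toAddMonoidHom),
    (continuous_of_discreteTopology (f := m.φ)).comp
      ((map_continuous (k.hom (m.α g))).comp (FreeProfinite.continuous_map m.cosetMap))⟩
  have h : (ψ : ContHom (P'.PermModule π) M'.A) = (m.mapCochain k).hom g := by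
    refine FreeProfinite.contHom_ext M'.primary fun y => ?_
    rw [RelCochain.hom_dirac, mapCochain_u, ← RelCochain.hom_dirac, ← FreeProfinite.map_dirac]
    rfl
  exact DFunLike.congr_fun h (Delta.inc δ)

/-- If the cochains describing two relative extensions have corresponding classes, then the
second extension is an image of the first one. -/
theorem isImage_of_cls_eq {k : RelCochain P M} {X : RelExt P M} {r : P.G → X.E}
    (h : k.Realizes X r) {k' : RelCochain P' M'} {X' : RelExt P' M'} {r' : P'.G → X'.E}
    (h' : k'.Realizes X' r') (hk : (m.mapCochain k).cls = k'.cls) : m.IsImage X X' := by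
  obtain ⟨ω, b, hu⟩ := (RelCochain.cls_eq_iff _ _).1 hk
  simp only [mapCochain_u] at hu
  have hζ : ∀ g g', k'.ζ g g' + b (g * g') = m.φ (k.ζ (m.α g) (m.α g')) + g • b g' + b g := by
    intro g g'
    have y : P'.Cosets := Classical.arbitrary _
    have h1 : m.φ (k.ζ (m.α g) (m.α g')) = _ := ((m.mapCochain k).coboundary g g' y).symm
    rw [h1, ← k'.coboundary g g' y, hu, hu, hu]
    simp only [mapCochain_u, mul_inv_rev, translate_mul, ContinuousMap.comp_apply, smul_add,
      smul_sub, mul_smul]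
    abel
  -- The elements of the pullback are `(ι a * r (α g), g)`, and such an element is sent to
  -- `ι (φ a - b g) * r' g`.
  let L := ((X.p : X.E →* P.G).comp (MonoidHom.fst X.E P'.G)).eqLocus
      ((m.α : P'.G →* P.G).comp (MonoidHom.snd X.E P'.G))
  choose a ha using fun z : L => X.exists_ι_mul_eq (e := z.1.1) (e' := r (m.α z.1.2))
    (Eq.trans z.2 (h.p_apply _).symm)
  have hac : Continuous a := X.continuous_of_ι <| by
    have : (fun z => X.ι (a z)) = fun z : L => z.1.1 * (r (m.α z.1.2))⁻¹ :=
      funext fun z => eq_mul_inv_of_mul_eq (ha z)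
    rw [this]
    exact (continuous_fst.comp continuous_subtype_val).mul (h.continuous.comp
      ((map_continuous m.α).comp (continuous_snd.comp continuous_subtype_val))).inv
  have hmul : ∀ z z' : L, a (z * z') = a z + m.α z.1.2 • a z' + k.ζ (m.α z.1.2) (m.α z'.1.2) := by
    intro z z'
    have h1 : X.ι (a (z * z')) * r (m.α (z.1.2 * z'.1.2)) = z.1.1 * z'.1.1 := ha (z * z')
    rw [← ha z, ← ha z', X.ι_mul_mul_ι_mul, h.p_apply, h.mul, X.ι_mul_ι_mul, map_mul] at h1
    exact X.ι_mul_right_injective h1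
  let F₀ : L →* X'.E := MonoidHom.mk' (fun z => X'.ι (m.φ (a z) - b z.1.2) * r' z.1.2) <| by
    intro z z'
    change X'.ι (m.φ (a (z * z')) - b (z.1.2 * z'.1.2)) * r' (z.1.2 * z'.1.2) = _
    rw [X'.ι_mul_mul_ι_mul, h'.p_apply, h'.mul, X'.ι_mul_ι_mul, hmul, map_add, map_add,
      m.map_smul, eq_sub_of_add_eq (hζ z.1.2 z'.1.2), smul_sub]
    congr 2
    abel
  have hF : ∀ z, F₀ z = X'.ι (m.φ (a z) - b z.1.2) * r' z.1.2 := fun _ => rfl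
  have hFc : Continuous F₀ := by
    have h1 : Continuous fun z : L => z.1.2 := continuous_snd.comp continuous_subtype_val
    exact (X'.continuous_ι.comp (((continuous_of_discreteTopology (f := m.φ)).comp hac).sub
      (b.continuous.comp h1))).mul (h'.continuous.comp h1)
  refine ⟨⟨F₀, hFc⟩, fun z => ?_, fun z c hz => ?_, fun x => ω (P'.coset 1 x), ?_, ?_⟩
  · change X'.p (F₀ z) = _
    rw [hF, map_mul, X'.p_ι, h'.p_apply, one_mul]
  · change F₀ z = _
    have h1 := ha z
    simp only [hz, map_one, h.apply_one, ← X.ι_add] at h1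
    have h2 := hζ 1 1
    simp only [map_one, mul_one, one_smul] at h2
    rw [hF, hz, h'.apply_one, ← X'.ι_add, ← X.ι_injective h1, map_add, eq_sub_of_add_eq h2]
    congr 1
    abel
  · exact ω.continuous.comp (P'.continuous_coset.comp (Continuous.prodMk_right 1))
  · intro x s z hz
    change _ = _ * F₀ z * _
    have h1 := ha z
    rw [hz, h.q_apply] at h1
    rw [h'.q_apply, hF, X'.conj_ι_mul, hz, h'.p_apply, X.ι_mul_right_injective h1, hu,
      translate_coset, cosetMap_coset, map_one, map_neg]
    have h2 : P'.coset ((s : P'.G)⁻¹ * 1) x = P'.coset 1 x := by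
      have := P'.coset_mul_mem 1 (inv_mem s.2)
      rwa [one_mul, ← mul_one (s : P'.G)⁻¹] at this
    rw [h2]
    congr 2
    abel

/-- An image of a relative extension described by `k` is described by a cochain with the class of
the image of `k`: with `F` as in `DataHom.IsImage`, the section is `g ↦ F (r (α g), g)`, and
the function `x ↦ a x` on the index space, viewed as a function on `G'/S'`, provides the
coboundary by which the cochain differs from the image of `k`. -/
theorem exists_realizes_of_isImage {k : RelCochain P M} {X : RelExt P M} {r : P.G → X.E}
    (h : k.Realizes X r) {X' : RelExt P' M'} (hX : m.IsImage X X') :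
    ∃ (k' : RelCochain P' M') (r' : P'.G → X'.E),
      k'.cls = (m.mapCochain k).cls ∧ k'.Realizes X' r' := by
  obtain ⟨F, hF1, hF2, a, hac, hF3⟩ := hX
  let R : P'.G → ((X.p : X.E →* P.G).comp (MonoidHom.fst X.E P'.G)).eqLocus
      ((m.α : P'.G →* P.G).comp (MonoidHom.snd X.E P'.G)) :=
    fun g => ⟨(r (m.α g), g), h.p_apply _⟩
  have hR : Continuous R := ((h.continuous.comp (map_continuous m.α)).prodMk
    continuous_id).subtype_mk _
  -- The inclusion of `A` into the pullback.
  let J : M.A → ((X.p : X.E →* P.G).comp (MonoidHom.fst X.E P'.G)).eqLocus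
      ((m.α : P'.G →* P.G).comp (MonoidHom.snd X.E P'.G)) :=
    fun c => ⟨(X.ι c, 1), (X.p_ι c).trans (map_one m.α).symm⟩
  have hJ : ∀ c, F (J c) = X'.ι (m.φ c) := fun c => hF2 _ c rfl
  let k' : RelCochain P' M' :=
    { u := ⟨fun z => (m.mapCochain k).u z + (z.1 • a (P'.index z.2) - a (P'.index z.2)), by
        have h1 : Continuous fun z : P'.G × P'.Cosets => a (P'.index z.2) :=
          hac.comp (P'.index.continuous.comp continuous_snd)
        exact (m.mapCochain k).u.continuous.add ((continuous_fst.smul h1).sub h1)⟩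
      ζ := (m.mapCochain k).ζ
      coboundary := fun g g' y => by
        rw [← (m.mapCochain k).coboundary g g' y]
        simp only [ContinuousMap.coe_mk, index_translate, smul_add, smul_sub, mul_smul]
        abel }
  have hk' : ∀ g y, k'.u (g, y) =
      m.φ (k.u (m.α g, m.cosetMap y)) + (g • a (P'.index y) - a (P'.index y)) := fun _ _ => rfl
  refine ⟨k', fun g => F (R g), Eq.symm ?_, F.continuous_toFun.comp hR, fun g => hF1 _, ?_, ?_⟩
  · refine (RelCochain.cls_eq_iff _ _).2 ⟨⟨fun y => a (P'.index y), hac.comp P'.index.continuous⟩,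
      0, fun g y => ?_⟩
    change _ = _ + (g • a (P'.index (P'.translate g⁻¹ y)) - a (P'.index y)) + 0
    rw [index_translate, add_zero]
    rfl
  · intro g g'
    rw [← map_mul]
    change _ = X'.ι (m.φ (k.ζ (m.α g) (m.α g'))) * _
    rw [← hJ, ← map_mul]
    congr 1
    refine Subtype.ext (Prod.ext ?_ (one_mul _).symm)
    change r (m.α g) * r (m.α g') = X.ι _ * r (m.α (g * g'))
    rw [h.mul, map_mul]
  · intro x s
    have h1 := hF3 x s (J (-k.u (m.α s, P.coset 1 (m.f x))) * R s) <| by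
      refine Prod.ext ?_ (one_mul _)
      exact (h.q_apply (m.f x) ⟨m.α s, m.map_mem x s s.2⟩).symm
    rw [map_mul, hJ, X'.conj_ι_mul, hF1] at h1
    rw [h1, hk', index_coset, cosetMap_coset, map_one, map_neg]
    congr 2
    change _ + _ - (s : P'.G) • a x = _
    abel

end DataHom

/-! ### The relative extension of a relative cochain -/

namespace RelCochain

variable (k : RelCochain P M)

theorem ζ_cocycle (g h l : P.G) :
    k.ζ g h + k.ζ (g * h) l = g • k.ζ h l + k.ζ g (h * l) := by
  have y : P.Cosets := Classical.arbitrary _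
  rw [← k.coboundary g h y, ← k.coboundary (g * h) l y, ← k.coboundary g (h * l) y,
    ← k.coboundary h l (P.translate g⁻¹ y)]
  simp only [smul_add, smul_sub, mul_smul, mul_inv_rev, translate_mul, ContinuousMap.comp_apply,
    mul_assoc]
  abel

theorem ζ_one_left (g : P.G) : k.ζ 1 g = k.ζ 1 1 := by
  have h := k.ζ_cocycle 1 1 g
  rw [one_mul, one_mul, one_smul] at h
  exact (add_right_cancel h).symm

theorem ζ_one_right (g : P.G) : k.ζ g 1 = g • k.ζ 1 1 := by
  have h := k.ζ_cocycle g 1 1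
  rw [mul_one, mul_one] at h
  exact add_right_cancel h

theorem continuous_ζ : Continuous fun z : P.G × P.G => k.ζ z.1 z.2 := by
  have y : P.Cosets := Classical.arbitrary _
  have h : Continuous fun z : P.G × P.G =>
      z.1 • k.u (z.2, P.translate z.1⁻¹ y) - k.u (z.1 * z.2, y) + k.u (z.1, y) := by
    have h1 : Continuous fun z : P.G × P.G => P.translate z.1⁻¹ y :=
      P.continuous_translate.comp (f := fun z : P.G × P.G => (z.1⁻¹, y)) (by fun_prop)
    exact ((continuous_fst.smul (k.u.continuous.comp (continuous_snd.prodMk h1))).sub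
      (k.u.continuous.comp (by fun_prop))).add (k.u.continuous.comp (by fun_prop))
  exact h.congr fun z => k.coboundary z.1 z.2 y

/-- The set `A × G`, with the group structure twisted by the 2-cocycle `ζ`.  The cocycle is not
normalised, so the unit is `(-ζ (1, 1), 1)`. -/
def Twisted (_k : RelCochain P M) : Type (max u w) := M.A × P.G

namespace Twisted

instance : TopologicalSpace k.Twisted := inferInstanceAs (TopologicalSpace (M.A × P.G))

instance : CompactSpace k.Twisted := inferInstanceAs (CompactSpace (M.A × P.G))

instance : TotallyDisconnectedSpace k.Twisted :=
  inferInstanceAs (TotallyDisconnectedSpace (M.A × P.G))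

instance : Mul k.Twisted := ⟨fun z z' => (z.1 + z.2 • z'.1 + k.ζ z.2 z'.2, z.2 * z'.2)⟩

instance : One k.Twisted := ⟨(-k.ζ 1 1, 1)⟩

instance : Inv k.Twisted := ⟨fun z => (-(z.2⁻¹ • z.1) - k.ζ z.2⁻¹ z.2 - k.ζ 1 1, z.2⁻¹)⟩

variable {k}

instance : Group k.Twisted := Group.ofLeftAxioms
  (by
    rintro ⟨a, g⟩ ⟨b, h⟩ ⟨c, l⟩
    refine Prod.ext ?_ (mul_assoc g h l)
    change a + g • b + k.ζ g h + (g * h) • c + k.ζ (g * h) l =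
      a + g • (b + h • c + k.ζ h l) + k.ζ g (h * l)
    rw [smul_add, smul_add, mul_smul, add_right_comm _ (k.ζ g h), add_assoc _ (k.ζ g h),
      k.ζ_cocycle]
    abel)
  (by
    rintro ⟨a, g⟩
    refine Prod.ext ?_ (one_mul g)
    change -k.ζ 1 1 + (1 : P.G) • a + k.ζ 1 g = a
    rw [one_smul, k.ζ_one_left g]
    abel)
  (by
    rintro ⟨a, g⟩
    refine Prod.ext ?_ (inv_mul_cancel g)
    change -(g⁻¹ • a) - k.ζ g⁻¹ g - k.ζ 1 1 + g⁻¹ • a + k.ζ g⁻¹ g = -k.ζ 1 1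
    abel)

instance : IsTopologicalGroup k.Twisted where
  continuous_mul := by
    have h : Continuous fun z : (M.A × P.G) × (M.A × P.G) =>
        (z.1.1 + z.1.2 • z.2.1 + k.ζ z.1.2 z.2.2, z.1.2 * z.2.2) :=
      ((by fun_prop : Continuous fun z : (M.A × P.G) × (M.A × P.G) =>
        z.1.1 + z.1.2 • z.2.1).add (k.continuous_ζ.comp
          (f := fun z : (M.A × P.G) × (M.A × P.G) => (z.1.2, z.2.2)) (by fun_prop))).prodMk
        (by fun_prop)
    exact h
  continuous_inv := by
    have h : Continuous fun z : M.A × P.G =>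
        (-(z.2⁻¹ • z.1) - k.ζ z.2⁻¹ z.2 - k.ζ 1 1, z.2⁻¹) :=
      (((by fun_prop : Continuous fun z : M.A × P.G => -(z.2⁻¹ • z.1)).sub (k.continuous_ζ.comp
        (f := fun z : M.A × P.G => (z.2⁻¹, z.2)) (by fun_prop))).sub continuous_const).prodMk
        (by fun_prop)
    exact h

variable (k)

/-- The twisted product as an extension of `G` by `A`. -/
def extension : GroupExtension (Multiplicative M.A) k.Twisted P.G where
  inl := MonoidHom.mk' (fun a => ((a.toAdd - k.ζ 1 1, 1) : M.A × P.G)) (by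
    intro a b
    refine Prod.ext ?_ (one_mul 1).symm
    change a.toAdd + b.toAdd - k.ζ 1 1 =
      a.toAdd - k.ζ 1 1 + (1 : P.G) • (b.toAdd - k.ζ 1 1) + k.ζ 1 1
    rw [one_smul]
    abel)
  rightHom := MonoidHom.mk' (fun z => z.2) fun _ _ => rfl
  inl_injective := by
    intro a b h
    exact Multiplicative.toAdd.injective (sub_left_injective (congrArg Prod.fst h))
  range_inl_eq_ker_rightHom := by
    ext ⟨a, g⟩
    constructor
    · rintro ⟨b, hb⟩
      exact (congrArg Prod.snd hb).symm
    · intro h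
      exact ⟨Multiplicative.ofAdd (a + k.ζ 1 1), Prod.ext (add_sub_cancel_right _ _)
        (h : g = 1).symm⟩
  rightHom_surjective g := ⟨((0, g) : M.A × P.G), rfl⟩

theorem inl_mul (a : M.A) (g : P.G) :
    (extension k).inl (Multiplicative.ofAdd a) * (show k.Twisted from ((0, g) : M.A × P.G)) =
      ((a, g) : M.A × P.G) := by
  refine Prod.ext ?_ (one_mul g)
  change a - k.ζ 1 1 + (1 : P.G) • (0 : M.A) + k.ζ 1 g = a
  rw [smul_zero, k.ζ_one_left g]
  abel

end Twisted

/-- The relative extension given by the twisted product, with the splittings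
`s ↦ (-u (s, S x), s)`. -/
def relExt : RelExt P M where
  E := ProfiniteGrp.of k.Twisted
  ext := Twisted.extension k
  continuous_rightHom := (continuous_snd : Continuous (Prod.snd : M.A × P.G → P.G))
  conj_inl := by
    intro (e : k.Twisted) a
    change e * (Twisted.extension k).inl _ * e⁻¹ = (Twisted.extension k).inl _
    rw [mul_inv_eq_iff_eq_mul]
    refine Prod.ext ?_ ((mul_one e.2).trans (one_mul e.2).symm)
    change e.1 + e.2 • (a - k.ζ 1 1) + k.ζ e.2 1 =
      e.2 • a - k.ζ 1 1 + (1 : P.G) • e.1 + k.ζ 1 e.2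
    rw [k.ζ_one_left e.2, k.ζ_one_right e.2, one_smul, smul_sub]
    abel
  q x := MonoidHom.mk' (fun s => ((-k.u (s, P.coset 1 x), (s : P.G)) : M.A × P.G)) <| by
    intro s t
    refine Prod.ext ?_ rfl
    change -k.u (s * t, P.coset 1 x) =
      -k.u (s, P.coset 1 x) + (s : P.G) • -k.u (t, P.coset 1 x) + k.ζ s t
    have h : P.translate (s : P.G)⁻¹ (P.coset 1 x) = P.coset 1 x := by
      have := P.coset_mul_mem 1 (inv_mem s.2)
      rwa [one_mul, ← mul_one (s : P.G)⁻¹] at this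
    rw [← k.coboundary s t (P.coset 1 x), h, smul_neg]
    abel
  continuous_q := by
    have h1 : Continuous fun z : P.Family => z.1.1 := continuous_fst.comp continuous_subtype_val
    have h2 : Continuous fun z : P.Family => P.coset 1 z.1.2 := P.continuous_coset.comp
      (f := fun z : P.Family => (1, z.1.2))
      (continuous_const.prodMk (continuous_snd.comp continuous_subtype_val))
    exact (k.u.continuous.comp (h1.prodMk h2)).neg.prodMk h1
  rightHom_q _ _ := rfl

theorem realizes_relExt :
    k.Realizes k.relExt (fun g => (show k.Twisted from ((0, g) : M.A × P.G))) where
  continuous := (Continuous.prodMk_right 0 : Continuous fun g : P.G => ((0 : M.A), g))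
  p_apply _ := rfl
  mul g h := by
    refine Eq.trans ?_ (Twisted.inl_mul k (k.ζ g h) (g * h)).symm
    refine Prod.ext ?_ rfl
    change 0 + g • (0 : M.A) + k.ζ g h = k.ζ g h
    rw [smul_zero, zero_add, zero_add]
  q_apply x s := (Twisted.inl_mul k (-k.u (s, P.coset 1 x)) s).symm

end RelCochain

/-! ### The relative cochain of a relative extension -/

namespace RelExt

variable (X : RelExt P M)

/-- The group `E` with the images of the splittings, as a profinite group pair. -/
def pair : ProfiniteGroupPair.{max u w, v} where
  G := X.E
  X := P.X
  nonempty := P.nonempty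
  S x := (X.q x).range
  isClosed_family := by
    have : CompactSpace P.Family := isCompact_iff_compactSpace.1 P.isClosed_family.isCompact
    have h : Continuous fun z : P.Family => (X.q z.1.2 ⟨z.1.1, z.2⟩, z.1.2) :=
      X.continuous_q.prodMk (continuous_snd.comp continuous_subtype_val)
    convert (isCompact_range h).isClosed using 1
    ext ⟨e, x⟩
    constructor
    · rintro ⟨s, hs⟩
      exact ⟨⟨(s, x), s.2⟩, Prod.ext hs rfl⟩
    · rintro ⟨⟨⟨s, y⟩, hs⟩, h⟩
      obtain rfl : y = x := congrArg Prod.snd h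
      exact ⟨⟨s, hs⟩, congrArg Prod.fst h⟩

/-- The map `⊔ E / q (S x) → G/S` has a continuous section sending trivial cosets to trivial
cosets.  It is encoded by the `A`-equivariant function `B` on `⊔ E / q (S x)`, here a function on
`E × X`, which vanishes on the image of the section.  It exists as `A` acts freely on the
profinite space `⊔ E / q (S x)`. -/
theorem exists_trivialization : ∃ B : C(X.E × P.X, M.A),
    (∀ a e x, B (X.ι a * e, x) = a + B (e, x)) ∧
    (∀ e x s, B (e * X.q x s, x) = B (e, x)) ∧ ∀ x, B (1, x) = 0 := by
  let _ : AddAction M.A X.pair.Cosets :=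
    { vadd := fun a => X.pair.translate (X.ι a)
      zero_vadd := fun y => by
        change X.pair.translate (X.ι 0) y = y
        rw [ι_zero]
        exact DFunLike.congr_fun X.pair.translate_one y
      add_vadd := fun a b y => by
        change X.pair.translate (X.ι (a + b)) y = _
        rw [ι_add]
        exact DFunLike.congr_fun (X.pair.translate_mul _ _) y }
  have _ : ContinuousConstVAdd M.A X.pair.Cosets :=
    ⟨fun a => (X.pair.translate (X.ι a)).continuous⟩
  obtain ⟨β, hβ⟩ := exists_equivariant (A := M.A) (Z := X.pair.Cosets) <| by
    intro a y hy
    obtain ⟨(e : X.E), (x : P.X), rfl⟩ := exists_coset y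
    obtain ⟨-, hmem⟩ :=
      coset_eq_iff.1 (hy : X.pair.coset (X.ι a * e) x = X.pair.coset e x)
    obtain ⟨s, hs⟩ : ∃ s : P.S x, X.q x s = (X.ι a * e)⁻¹ * e := hmem
    have h1 := congrArg X.p hs
    rw [X.p_q, map_mul, map_inv, map_mul, p_ι, one_mul, inv_mul_cancel] at h1
    rw [show s = 1 from Subtype.ext h1, map_one, eq_comm, inv_mul_eq_one, mul_eq_right] at hs
    exact X.ι_injective (hs.trans X.ι_zero.symm)
  have hcont := X.pair.continuous_coset
  -- Subtracting the values at the trivial cosets, which depend on `x` only, gives `B (1, x) = 0`.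
  refine ⟨⟨fun z : X.E × P.X => β (X.pair.coset z.1 z.2) - β (X.pair.coset (1 : X.E) z.2),
    (β.continuous.comp hcont).sub ((β.continuous.comp hcont).comp
      (f := fun z : X.E × P.X => ((1 : X.E), z.2)) (by fun_prop))⟩, ?_, ?_, ?_⟩
  · intro a e x
    change β (a +ᵥ X.pair.coset e x) - _ = a + (β (X.pair.coset e x) - _)
    rw [hβ, add_sub_assoc]
  · intro e x s
    exact congrArg (fun y => β y - β (X.pair.coset (1 : X.E) x))
      (X.pair.coset_mul_mem e (s := X.q x s) (x := x) ⟨s, rfl⟩)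
  · intro x
    exact sub_self _

/-- Every relative extension is described by a relative cochain.  Given a function `B` as above,
the section `r` singles out the elements of `E` where `B` vanishes for a fixed point of `X`, and the
cochain measures how far the section of `⊔ E / q (S x) → G/S` defined by `B` is from commuting with
the action of `r`. -/
theorem exists_realizes : ∃ (k : RelCochain P M) (r : P.G → X.E), k.Realizes X r := by
  obtain ⟨B, hB1, hB2, hB3⟩ := X.exists_trivialization
  let x₀ : P.X := P.nonempty.some
  let t : P.G → X.E := Function.surjInv X.p_surjective
  have ht : ∀ g, X.p (t g) = g := Function.surjInv_eq X.p_surjective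
  let r : P.G → X.E := fun g => X.ι (-B (t g, x₀)) * t g
  have hr : ∀ g, X.p (r g) = g := fun g => by rw [map_mul, p_ι, one_mul, ht]
  have hrp : ∀ e, r (X.p e) = X.ι (-B (e, x₀)) * e := by
    intro e
    obtain ⟨a, ha⟩ := X.exists_ι_mul_eq (ht (X.p e))
    change X.ι (-B (t (X.p e), x₀)) * t (X.p e) = _
    rw [← ha, hB1, X.ι_mul_ι_mul]
    congr 2
    abel
  have hrc : Continuous r := by
    have hq : IsQuotientMap X.p :=
      IsQuotientMap.of_surjective_continuous X.p_surjective (map_continuous X.p)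
    rw [hq.continuous_iff]
    have h : Continuous fun e => X.ι (-B (e, x₀)) * e :=
      (X.continuous_ι.comp (B.continuous.comp (Continuous.prodMk_left x₀)).neg).mul continuous_id
    exact h.congr fun e => (hrp e).symm
  -- The section stays opaque from here on, so that rewriting does not unfold it.
  clear_value r
  choose ζ hζ using fun g h => X.exists_ι_mul_eq (e := r g * r h) (e' := r (g * h))
    (by rw [map_mul, hr, hr, hr])
  -- The cochain is `u (g, p e (S x)) = B (e, x) - g • B ((r g)⁻¹ * e, x)`, which does not depend on
  -- the choice of `e` and descends along the quotient map `G × E × X → G × G/S`.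
  let f : C(P.G × X.E × P.X, M.A) :=
    ⟨fun z => B z.2 - z.1 • B ((r z.1)⁻¹ * z.2.1, z.2.2),
      (B.continuous.comp continuous_snd).sub (continuous_fst.smul (B.continuous.comp
        (((hrc.comp continuous_fst).inv.mul (continuous_fst.comp continuous_snd)).prodMk
          (continuous_snd.comp continuous_snd))))⟩
  let c : C(P.G × X.E × P.X, P.G × P.Cosets) :=
    ⟨fun z => (z.1, P.coset (X.p z.2.1) z.2.2), continuous_fst.prodMk
      (P.continuous_coset.comp (((map_continuous X.p).comp
        (continuous_fst.comp continuous_snd)).prodMk (continuous_snd.comp continuous_snd)))⟩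
  have hcs : Function.Surjective c := by
    rintro ⟨g, y⟩
    obtain ⟨l, x, rfl⟩ := exists_coset y
    exact ⟨(g, t l, x), Prod.ext rfl (congrArg (fun l => P.coset l x) (ht l))⟩
  have hcq : IsQuotientMap c := IsQuotientMap.of_surjective_continuous hcs c.continuous
  have hfc : Function.FactorsThrough f c := by
    rintro ⟨g, e, x⟩ ⟨g', e', x'⟩ h
    obtain rfl : g = g' := congrArg Prod.fst h
    obtain ⟨rfl, hs⟩ := coset_eq_iff.1 (congrArg Prod.snd h)
    obtain ⟨a, ha⟩ := X.exists_ι_mul_eq (e := e') (e' := e * X.q x ⟨_, hs⟩) (by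
      rw [map_mul, X.p_q]
      exact (mul_inv_cancel_left _ _).symm)
    change B (e, x) - g • B ((r g)⁻¹ * e, x) = B (e', x) - g • B ((r g)⁻¹ * e', x)
    rw [← ha, ← mul_assoc (r g)⁻¹, X.mul_ι, mul_assoc, hB1, hB1, ← mul_assoc (r g)⁻¹, hB2, hB2,
      map_inv, hr, smul_add, smul_inv_smul]
    abel
  let u : C(P.G × P.Cosets, M.A) := hcq.lift f hfc
  have hu : ∀ g e x, u (g, P.coset (X.p e) x) = B (e, x) - g • B ((r g)⁻¹ * e, x) := fun g e x =>
    DFunLike.congr_fun (hcq.lift_comp f hfc) (g, e, x)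
  refine ⟨⟨u, ζ, fun g h y => ?_⟩, r, hrc, hr, fun g h => (hζ g h).symm, fun x s => ?_⟩
  · obtain ⟨l, x, rfl⟩ := exists_coset y
    obtain ⟨e, rfl⟩ := X.p_surjective l
    have h1 : P.translate g⁻¹ (P.coset (X.p e) x) = P.coset (X.p ((r g)⁻¹ * e)) x := by
      rw [translate_coset, map_mul, map_inv, hr]
    have h2 : (r h)⁻¹ * ((r g)⁻¹ * e) =
        X.ι ((g * h)⁻¹ • -ζ g h) * ((r (g * h))⁻¹ * e) := by
      rw [← mul_assoc, ← mul_inv_rev, ← hζ, mul_inv_rev, ← ι_neg, X.mul_ι, map_inv, hr, mul_assoc]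
    rw [h1, hu, hu, hu, h2, hB1, smul_sub, ← mul_smul, smul_add, smul_inv_smul]
    abel
  · obtain ⟨a, ha⟩ := X.exists_ι_mul_eq (e := X.q x s) (e' := r s) (by rw [X.p_q, hr])
    have h1 : (r s)⁻¹ = X.ι ((s : P.G)⁻¹ • a) * (1 * X.q x s⁻¹) := by
      rw [one_mul, map_inv, ← ha, mul_inv_rev, ← ι_neg, X.mul_ι, X.ι_mul_ι_mul, map_inv, hr,
        smul_neg, add_neg_cancel, ι_zero, one_mul]
    have h2 : u (s, P.coset 1 x) = -a := by
      have h3 := hu s 1 x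
      rw [map_one, hB3, mul_one, h1, hB1, hB2, hB3, add_zero, smul_inv_smul, zero_sub] at h3
      exact h3
    rw [← ha]
    change _ = X.ι (-u (s, P.coset 1 x)) * _
    rw [h2, neg_neg]

end RelExt

/-! ### Equivalences as images under the identity -/

namespace DataHom

/-- The identity morphism. -/
def id (P : ProfiniteGroupPair.{u, v}) (M : FiniteModule.{u, w} π P.G) : DataHom P M P M where
  α := ContinuousMonoidHom.id P.G
  f := ContinuousMap.id P.X
  map_mem _ _ h := h
  φ := AddMonoidHom.id M.A
  map_smul _ _ := rfl

theorem mapCochain_id_cls (k : RelCochain P M) : ((id P M).mapCochain k).cls = k.cls := by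
  refine (RelCochain.cls_eq_iff _ _).2 ⟨0, 0, fun g y => ?_⟩
  obtain ⟨l, x, rfl⟩ := exists_coset y
  simp only [ContinuousMap.zero_apply, smul_zero, sub_zero, add_zero]
  rfl

/-- A homomorphism of extensions which is the identity on `G` and on `A` is an isomorphism, so the
images under the identity are the equivalent relative extensions. -/
theorem isImage_id_iff {X X' : RelExt P M} : (id P M).IsImage X X' ↔ X.Equivalent X' := by
  constructor
  · rintro ⟨F, hF1, hF2, a, hac, hF3⟩
    let graph : X.E →* ((X.p : X.E →* P.G).comp (MonoidHom.fst X.E P.G)).eqLocus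
        (((id P M).α : P.G →* P.G).comp (MonoidHom.snd X.E P.G)) :=
      ((MonoidHom.id X.E).prod (X.p : X.E →* P.G)).codRestrict _ fun _ => rfl
    have hgraph : Continuous graph := (continuous_id.prodMk (map_continuous X.p)).subtype_mk _
    let f : X.E →* X'.E := (F : _ →* X'.E).comp graph
    have hfc : Continuous f := F.continuous_toFun.comp hgraph
    have hfp : ∀ e, X'.p (f e) = X.p e := fun e => hF1 _
    have hfι : ∀ b, f (X.ι b) = X'.ι b := fun b => hF2 _ b (Prod.ext rfl (X.p_ι b))
    have hinj : Function.Injective f := by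
      refine (injective_iff_map_eq_one f).2 fun e he => ?_
      obtain ⟨b, rfl⟩ := X.exists_ι_eq (e := e) (by rw [← hfp, he, map_one])
      rw [hfι, ← X'.ι_zero] at he
      rw [X'.ι_injective he, X.ι_zero]
    have hsurj : Function.Surjective f := by
      intro e'
      obtain ⟨e, he⟩ := X.p_surjective (X'.p e')
      obtain ⟨b, hb⟩ := X'.exists_ι_mul_eq (e := e') (e' := f e) (by rw [hfp, he])
      exact ⟨X.ι b * e, by rw [map_mul, hfι, hb]⟩
    let f' : X.E ≃* X'.E := MulEquiv.ofBijective f ⟨hinj, hsurj⟩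
    have hf'c : Continuous f' := hfc
    exact ⟨{ f' with
        continuous_toFun := hf'c
        continuous_invFun := hf'c.continuous_symm_of_equiv_compact_to_t2 (f := f'.toEquiv) },
      hfι, hfp, a, hac, fun x s => hF3 x s _ (Prod.ext rfl (X.p_q x s))⟩
  · rintro ⟨f, hf1, hf2, a, hac, hf3⟩
    refine ⟨⟨(f : X.E →* X'.E).comp ((MonoidHom.fst X.E P.G).comp (Subgroup.subtype _)),
      f.continuous_toFun.comp (continuous_fst.comp continuous_subtype_val)⟩,
      fun z => (hf2 _).trans z.2, fun z b hz => ?_, a, hac, fun x s z hz => ?_⟩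
    · change f z.1.1 = X'.ι b
      rw [hz, hf1]
    · change _ = _ * f z.1.1 * _
      rw [hz, hf3]
      rfl

end DataHom

/-! ### The bijection -/

theorem exists_corresponds_relExt (c : RelH2 P M) : ∃ X : RelExt P M, Corresponds c X := by
  obtain ⟨k, rfl⟩ := RelCochain.exists_cls_eq c
  exact ⟨k.relExt, RelCochain.corresponds_iff.2 ⟨k, _, rfl, k.realizes_relExt⟩⟩

theorem exists_corresponds_class (X : RelExt P M) : ∃ c : RelH2 P M, Corresponds c X := by
  obtain ⟨k, r, h⟩ := X.exists_realizes
  exact ⟨k.cls, RelCochain.corresponds_iff.2 ⟨k, r, rfl, h⟩⟩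

theorem Corresponds.class_unique {c c' : RelH2 P M} {X : RelExt P M} (h : Corresponds c X)
    (h' : Corresponds c' X) : c = c' := by
  obtain ⟨k, r, rfl, hk⟩ := RelCochain.corresponds_iff.1 h
  obtain ⟨k', r', rfl, hk'⟩ := RelCochain.corresponds_iff.1 h'
  exact hk.cls_eq hk'

/-- The correspondence is functorial. -/
theorem Corresponds.map_iff {P' : ProfiniteGroupPair.{u, v}} {M' : FiniteModule.{u, w} π P'.G}
    (m : DataHom P M P' M') {c : RelH2 P M} {X : RelExt P M} (h : Corresponds c X)
    {X' : RelExt P' M'} : Corresponds (m.mapH2 c) X' ↔ m.IsImage X X' := by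
  obtain ⟨k, r, rfl, hk⟩ := RelCochain.corresponds_iff.1 h
  rw [m.mapH2_cls]
  constructor
  · intro h'
    obtain ⟨k', r', hc, hk'⟩ := RelCochain.corresponds_iff.1 h'
    exact m.isImage_of_cls_eq hk hk' hc.symm
  · intro h'
    exact RelCochain.corresponds_iff.2 (m.exists_realizes_of_isImage hk h')

theorem Corresponds.iff_equivalent {c : RelH2 P M} {X X' : RelExt P M} (h : Corresponds c X) :
    Corresponds c X' ↔ X.Equivalent X' := by
  have hc : (DataHom.id P M).mapH2 c = c := by
    obtain ⟨k, rfl⟩ := RelCochain.exists_cls_eq c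
    rw [DataHom.mapH2_cls, DataHom.mapCochain_id_cls]
  rw [← DataHom.isImage_id_iff, ← h.map_iff (DataHom.id P M), hc]

/-- The relative extension class of a relative cohomology class. -/
def toRelExtClass (P : ProfiniteGroupPair.{u, v}) (M : FiniteModule.{u, w} π P.G)
    (c : RelH2 P M) : RelExtClass P M :=
  Quotient.mk _ (exists_corresponds_relExt c).choose

theorem toRelExtClass_eq_iff {c : RelH2 P M} {X : RelExt P M} :
    toRelExtClass P M c = Quotient.mk _ X ↔ Corresponds c X := by
  rw [(exists_corresponds_relExt c).choose_spec.iff_equivalent]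
  exact Quotient.eq

theorem toRelExtClass_bijective (P : ProfiniteGroupPair.{u, v}) (M : FiniteModule.{u, w} π P.G) :
    Function.Bijective (toRelExtClass P M) := by
  refine ⟨fun c c' h => ?_, fun Z => ?_⟩
  · exact (toRelExtClass_eq_iff.1 h).class_unique (exists_corresponds_relExt c').choose_spec
  · induction Z using Quotient.inductionOn with
    | h X => exact (exists_corresponds_class X).imp fun c hc => toRelExtClass_eq_iff.2 hc

end RelCohom

end

/-- There is a bijection between `H²(G, S; A)` and the set of equivalence classes of relative
extensions of `(G, S)` by `A`, given on cocycles by the explicit correspondence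
`RelCohom.Corresponds`, and natural in `(G, S)` and `A`. -/
theorem mainTheorem2 (π : Set Nat.Primes) (hπ : π.Nonempty) :
    ∃ Φ : ∀ (P : RelCohom.ProfiniteGroupPair.{u, v}) (M : RelCohom.FiniteModule.{u, w} π P.G),
        RelCohom.RelH2 P M ≃ RelCohom.RelExtClass P M,
      (∀ (P : RelCohom.ProfiniteGroupPair.{u, v}) (M : RelCohom.FiniteModule.{u, w} π P.G)
        (c : RelCohom.RelH2 P M) (X : RelCohom.RelExt P M),
        Φ P M c = Quotient.mk _ X ↔ RelCohom.Corresponds c X) ∧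
      (∀ (P : RelCohom.ProfiniteGroupPair.{u, v}) (M : RelCohom.FiniteModule.{u, w} π P.G)
        (P' : RelCohom.ProfiniteGroupPair.{u, v}) (M' : RelCohom.FiniteModule.{u, w} π P'.G)
        (m : RelCohom.DataHom P M P' M') (c : RelCohom.RelH2 P M)
        (X : RelCohom.RelExt P M) (X' : RelCohom.RelExt P' M'),
        Φ P M c = Quotient.mk _ X →
          (Φ P' M' (m.mapH2 c) = Quotient.mk _ X' ↔ m.IsImage X X')) := by
  refine ⟨fun P M => Equiv.ofBijective _ (RelCohom.toRelExtClass_bijective P M),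
    fun P M c X => RelCohom.toRelExtClass_eq_iff, fun P M P' M' m c X X' h => ?_⟩
  exact RelCohom.toRelExtClass_eq_iff.trans ((RelCohom.toRelExtClass_eq_iff.1 h).map_iff m)
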